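/- **Lemma 6.2 (Entropy Lemma).** *Conventions.* Logarithms are natural and $n!_t := n(n-1)\cdots(n-t+1)$. Let $\Gamma$ be a tripartite graph with parts $V^1,V^2,V^3$, each of size $n$. For $\varepsilon>0$ and $0<d\le1$, it is *$(\varepsilon,d)$-super-regular* if for all $i\ne j$: the density $d_\Gamma(V^i,V^j)=e_\Gamma(V^i,V^j)/(|V^i||V^j|)$ equals $d$; $|d_\Gamma(X,Y)-d|<\varepsilon$ for all $X\subseteq V^i$, $Y\subseteq V^j$ with $|X|\ge\varepsilon|V^i|$, $|Y|\ge\varepsilon|V^j|$; and every vertex of $V^i$ has at least $(d-\varepsilon)|V^j|$ neighbours in $V^j$. The random graph $\Gamma_p$ is the spanning subgraph of $\Gamma$ that keeps each edge of $\Gamma$ independently with probability $p$. Let $D_t$ be the graph on $[t]\times[3]$ consisting of the $t$ disjoint triangles $\{(s,1),(s,2),(s,3)\}$, $s\in[t]$. For a graph $G$ on $V^1\cup V^2\cup V^3$ whose edges all lie between different parts, vertices $\underline u=(u_1,\dots,u_{\ell-1})\in V^1\times\dots\times V^{\ell-1}$ (the empty tuple if $\ell=1$) and $u\in V^\ell$,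 let $\Psi^t_{\hat{\underline u},\hat u}(G)$ be the set of injective homomorphisms $\psi:D_t\to G$ with $\psi([t]\times\{i\})\subseteq V^i$ for $i\in[3]$ whose image contains none of $u_1,\dots,u_{\ell-1},u$. For such $\psi$ and $v\in V^\ell$, put $\psi_v=\emptyset$ and $Y_v(\psi)=0$ if $v$ is isolated in the graph $\psi(D_t)$; otherwise put $Y_v(\psi)=1$ and let $\psi_v$ be the pair consisting of the other two vertices of the triangle of $\psi(D_t)$ that contains $v$. For a random variable $X$ with finitely many values and an event $E$ of positive probability, $h(X\mid E)=-\sum_x \mathbb P(X=x\mid E)\log\mathbb P(X=x\mid E)$. *Statement.* For all $0<\beta,d\le 1$ and $L>0$ there exist $\eta\in(0,1)$, $\varepsilon>0$ and $C>0$ such that for all sufficiently large $n\in\mathbb N$ and every $p\le1$ with $p\ge C(\log n)^{1/3}n^{-2/3}$ the following holds. Let $\Gamma$ be an $(\varepsilon,d)$-super-regular tripartite graph with parts $V^1,V^2,V^3$ of size $n$, let $t\in\mathbb N$ with $(1-\eta)n\le t<n$, let $\ell\in[3]$, $\underline u=(u_1,\dots,u_{\ell-1})\in V^1\times\dots\times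 V^{\ell-1}$ and $u\in V^\ell$. Then with probability at least $1-n^{-L}$ the random graph $\Gamma_p$ has the following property: if $$\bigl|\Psi^t_{\hat{\underline u},\hat u}(\Gamma_p)\bigr|\ \ge\ (1-\eta)^n\,(pd)^{3t}\,\bigl((n-1)!_t\bigr)^{\ell}\,\bigl(n!_t\bigr)^{3-\ell},$$ then this set is non-empty and, for $\psi^*$ chosen uniformly at random from it, all but at most $\beta n$ vertices $v\in V^\ell$ satisfy $\mathbb P(Y_v(\psi^*)=1)>0$ and $$h\bigl(\psi^*_v \,\big|\, Y_v(\psi^*)=1\bigr)\ \ge\ \log\bigl((pd)^3n^2\bigr)-\beta .$$ -/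

import Mathlib

open MeasureTheory

noncomputable section

/-! ### Super-regular tripartite graphs -/

section Regularity

variable {W : Type*}

/-- `deg_G(v; A)`, the number of neighbours of `v` in `A`. -/
def degIn (G : SimpleGraph W) (v : W) (A : Finset W) : ℕ :=
  open Classical in (A.filter (fun a => G.Adj v a)).card

/-- `(A, B)` is `(ε, d)`-regular in `G`: it is `ε`-regular and has density exactly `d`. -/
def IsRegularPair (G : SimpleGraph W) (ε d : ℝ) (A B : Finset W) : Prop :=
  open Classical in G.IsUniform ε A B ∧ ((G.edgeDensity A B : ℚ) : ℝ) = d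

/-- `(A, B)` is `(ε, d, δ)`-super-regular in `G`. -/
def IsSuperRegularPair (G : SimpleGraph W) (ε d δ : ℝ) (A B : Finset W) : Prop :=
  IsRegularPair G ε d A B ∧
    (∀ v ∈ B, δ * (A.card : ℝ) ≤ (degIn G v A : ℝ)) ∧
    (∀ v ∈ A, δ * (B.card : ℝ) ≤ (degIn G v B : ℝ))

end Regularity

/-- The `i`-th vertex class, as a set of vertices of the disjoint union of the three classes. -/
def partSet (V : Fin 3 → Type*) [∀ i, Fintype (V i)] (i : Fin 3) : Finset (Σ i, V i) :=
  Finset.univ.map (Function.Embedding.sigmaMk i)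

/-- `Γ` is an `(ε, d)`-super-regular tripartite graph with vertex classes `V 0`, `V 1`, `V 2`:
all edges go between different classes, and each pair of classes is
`(ε, d, d - ε)`-super-regular. -/
def IsSuperRegularTripartite {V : Fin 3 → Type*} [∀ i, Fintype (V i)]
    (Γ : SimpleGraph (Σ i, V i)) (ε d : ℝ) : Prop :=
  Γ ≤ SimpleGraph.completeMultipartiteGraph V ∧
    ∀ i j : Fin 3, i ≠ j → IsSuperRegularPair Γ ε d (d - ε) (partSet V i) (partSet V j)

/-! ### The random sparsification -/

/-- The law of `Γ_p`, the random spanning subgraph of `Γ` in which every edge of `Γ` is kept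
independently with probability `p`. -/
def sparsification {W : Type*} (Γ : SimpleGraph W) (p : unitInterval) :
    Measure (SimpleGraph W) :=
  (ProbabilityTheory.setBernoulli Γ.edgeSet p).comap SimpleGraph.edgeSet

/-! ### Embeddings of vertex-disjoint triangles -/

/-- `D_t`: the graph on `[t] × [3]` that consists of `t` labelled vertex-disjoint triangles. -/
def triangles (t : ℕ) : SimpleGraph (Fin t × Fin 3) where
  Adj a b := a.1 = b.1 ∧ a.2 ≠ b.2
  symm := ⟨fun _ _ h => ⟨h.1.symm, h.2.symm⟩⟩
  loopless := ⟨fun _ h => h.2 rfl⟩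

section Embeddings

variable {V : Fin 3 → Type*} [∀ i, Fintype (V i)]

/-- `Ψ^t(G)`: the labelled (not necessarily induced) embeddings of `D_t` into `G` that map
`[t] × {i}` into the `i`-th class. -/
def embeddings (G : SimpleGraph (Σ i, V i)) (t : ℕ) : Finset (Fin t × Fin 3 → Σ i, V i) :=
  open Classical in Finset.univ.filter (fun ψ =>
    Function.Injective ψ ∧ (∀ a b, (triangles t).Adj a b → G.Adj (ψ a) (ψ b)) ∧
      ∀ s i, (ψ (s, i)).1 = i)

/-- The tuples in `𝒱` of length `k ≤ 3`: one vertex from each of the first `k` classes. -/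
def VertexTuple (V : Fin 3 → Type*) (k : ℕ) : Type _ :=
  ∀ i : Fin 3, (i : ℕ) < k → V i

/-- The embeddings in `Ψ^t(G)` that avoid all vertices of the tuple `us` and the further
vertex `u` of the class `ℓ`. -/
def embeddingsAvoiding (G : SimpleGraph (Σ i, V i)) (t : ℕ) {k : ℕ} (us : VertexTuple V k)
    {ℓ : Fin 3} (u : V ℓ) : Finset (Fin t × Fin 3 → Σ i, V i) :=
  open Classical in (embeddings G t).filter (fun ψ =>
    (∀ (s : Fin t) (i : Fin 3) (hi : (i : ℕ) < k), ψ (s, i) ≠ ⟨i, us i hi⟩) ∧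
      ∀ s : Fin t, ψ (s, ℓ) ≠ ⟨ℓ, u⟩)

/-- `ψ_v` for a vertex `v` of the class `ℓ`: it is `none` (for `∅`) if `v` is isolated in the
embedded graph `ψ(D_t)`, and otherwise the family of the neighbourhoods of `v` in `ψ(D_t)`
within each of the two other classes. -/
def triangleAt {t : ℕ} {ℓ : Fin 3} (v : V ℓ) (ψ : Fin t × Fin 3 → Σ i, V i) :
    Option (∀ j : {j : Fin 3 // j ≠ ℓ}, Finset (V j)) :=
  open Classical in
  if ((triangles t).map ψ).IsIsolated ⟨ℓ, v⟩ then none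
  else some (fun j => Finset.univ.filter
    (fun w : V j => ((triangles t).map ψ).Adj ⟨ℓ, v⟩ ⟨(j : Fin 3), w⟩))

/-- `Y_v(ψ)`: the indicator of `ψ_v ≠ ∅`. -/
def coveredIndicator {t : ℕ} {ℓ : Fin 3} (v : V ℓ) (ψ : Fin t × Fin 3 → Σ i, V i) : ℕ :=
  open Classical in if triangleAt v ψ ≠ none then 1 else 0

end Embeddings

/-! ### Entropy -/

/-- The entropy (in nats) of a distribution on a finite set. -/
def entropy {S : Type*} [Fintype S] (q : PMF S) : ℝ :=
  ∑ x, Real.negMulLog (q x).toReal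

/-- The entropy `h(X | E)` of the random variable `X`, conditional on the event `E` of positive
probability: the entropy of the distribution `P(X = · | E)`. -/
def condEntropy {Ω S : Type*} [Fintype S] (P : PMF Ω) (X : Ω → S) (E : Set Ω)
    (hE : ∃ ω ∈ E, ω ∈ P.support) : ℝ :=
  entropy ((P.filter E hE).map X)

/-- The benchmark `H(n, p, d) = log ((pd)^3 n^2)`. -/
def benchmarkEntropy (n : ℕ) (p d : ℝ) : ℝ :=
  Real.log ((p * d) ^ 3 * (n : ℝ) ^ 2)

/-- Let `ψ*` be uniformly distributed on `Ψ`. The vertex `v` is covered with positive probability,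
and `h(ψ*_v | Y_v(ψ*) = 1) ≥ b`. -/
def HasCondEntropyAtLeast {V : Fin 3 → Type*} [∀ i, Fintype (V i)] {t : ℕ}
    (Ψ : Finset (Fin t × Fin 3 → Σ i, V i)) (hΨ : Ψ.Nonempty) {ℓ : Fin 3} (v : V ℓ) (b : ℝ) :
    Prop :=
  open Classical in
  ∃ hE : ∃ ψ ∈ {ψ | coveredIndicator v ψ = 1}, ψ ∈ (PMF.uniformOfFinset Ψ hΨ).support,
    b ≤ condEntropy (PMF.uniformOfFinset Ψ hΨ) (triangleAt v) {ψ | coveredIndicator v ψ = 1} hE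

end

/-!
Let `T = (pd)³n²` be the expected number of triangles at a vertex. The hypothesis on `p` makes `T`
a large multiple of `log n`, and the proof separates the randomness of `Γ_p` from the counting of
embeddings.

*The random graph.* With probability `1 - n ^ (-L)` the graph `Γ_p` is typical (`IsTypical`): no
vertex lies in many more than `p³` times as many triangles as in `Γ`, and no two vertices have a
codegree comparable to `T`. The triangle count at `x` is a cubic polynomial in independent Bernoulli
variables; it is controlled by revealing the edges at `x` to one class, then those to the other
class, then the edges in between, each step being a linear form whose weights are already known
(`bernoulliProb_sum_ge_le`, `bernoulliProb_triangles_le`). By regularity all but few vertices of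
each class lie in at most about `d³n²` triangles of `Γ` (`exists_card_triangles_le`).

*Counting.* An embedding is a choice of roots in the class `ℓ` together with pairs completing them
to disjoint triangles. By Gibbs' inequality (`card_mul_log_card_le`), the logarithm of the number of
embeddings is at most the mean of `-log q` for any explicit subprobability `q`. Assign the roots to
`M` blocks at random, and let `q` predict the triangles block by block. The triangle at a root is
predicted uniformly among those that avoid all triangles of earlier blocks. If the root has small
conditional entropy and lies in one of the first blocks, it is predicted instead by its conditional
law. For a root in block `k`, a triangle at it is available with probability about `((M - k) / M)²`,
and the exceptions (`entangledPairs`) are negligible in sum because codegrees are small and an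
embedding misses few vertices. So the mean cost is at most `t (log T - 2)` up to a small linear error, minus a linear gain if there are
linearly many roots of small entropy (`log_card_le_of_bad`). The assumed number of embeddings has a
logarithm of at least the same benchmark up to a small linear error, by Stirling-type estimates
(`log_descFactorial_pred_ge`), so roots of small entropy are few (`IsTypical.ncard_le`).
-/

noncomputable section

/-! ### The weighted counting argument -/

/-- Gibbs' inequality for the uniform distribution on `Ψ` and a positive weight of total mass at most
`K`, multiplied by the size of `Ψ`. -/
theorem card_mul_log_card_le {X : Type*} (Ψ : Finset X) (w : X → ℝ) (K : ℝ) (hK : 0 < K)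
    (hw : ∀ ψ ∈ Ψ, 0 < w ψ) (hsum : ∑ ψ ∈ Ψ, w ψ ≤ K) :
    (Ψ.card : ℝ) * Real.log Ψ.card ≤ Ψ.card * Real.log K + ∑ ψ ∈ Ψ, -Real.log (w ψ) := by
  rcases Ψ.eq_empty_or_nonempty with rfl | hne
  · simp
  have hc : (0 : ℝ) < Ψ.card := by exact_mod_cast hne.card_pos
  have h1 : ∀ ψ ∈ Ψ, Real.log Ψ.card + Real.log (w ψ) - Real.log K ≤ Ψ.card * w ψ / K - 1 := by
    intro ψ hψ
    have := hw ψ hψ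
    rw [← Real.log_mul hc.ne' this.ne', ← Real.log_div (by positivity) hK.ne']
    exact Real.log_le_sub_one_of_pos (by positivity)
  have h2 := Finset.sum_le_sum h1
  simp only [Finset.sum_sub_distrib, Finset.sum_add_distrib, Finset.sum_const, nsmul_eq_mul,
    ← Finset.sum_div, ← Finset.mul_sum, mul_one] at h2
  have h3 : (Ψ.card : ℝ) * (∑ ψ ∈ Ψ, w ψ) / K ≤ Ψ.card := by
    rw [div_le_iff₀ hK]; gcongr
  rw [Finset.sum_neg_distrib]
  linarith

/-- Resampling one coordinate of a uniformly random function does not change averages. -/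
theorem sum_sum_update {ι X : Type*} [Fintype ι] [DecidableEq ι] [Fintype X] (i : ι)
    (F : (ι → X) → ℝ) :
    ∑ y : X, ∑ x : ι → X, F (Function.update x i y) = Fintype.card X * ∑ x, F x := by
  have hinv : Function.Involutive
      (fun z : X × (ι → X) => (z.2 i, Function.update z.2 i z.1)) := by
    rintro ⟨y, x⟩
    simp
  calc ∑ y : X, ∑ x : ι → X, F (Function.update x i y)
      = ∑ z : X × (ι → X), F (Function.update z.2 i z.1) := by
        rw [Fintype.sum_prod_type]
    _ = ∑ z : X × (ι → X), F z.2 := by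
        exact Equiv.sum_comp hinv.toPerm (fun z => F z.2)
    _ = _ := by
        rw [Fintype.sum_prod_type]; simp

/-- Total mass of a sequentially defined sub-probability: the factor `w i` is a subprobability in
the coordinate `i` and otherwise sees only coordinates of smaller rank. -/
theorem sum_prod_le_one_of_rank {ι X : Type*} [Fintype ι] [DecidableEq ι] [Fintype X]
    (r : ι → ℕ) (w : ι → (ι → X) → ℝ) (hw : ∀ i x, 0 ≤ w i x)
    (hdep : ∀ i j x y, j ≠ i → r i ≤ r j → w i (Function.update x j y) = w i x)
    (hsum : ∀ i x, ∑ y, w i (Function.update x i y) ≤ 1) :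
    ∑ x : ι → X, ∏ i, w i x ≤ 1 := by
  rcases isEmpty_or_nonempty X with hX | hX
  · rcases isEmpty_or_nonempty ι with hι | ⟨⟨i⟩⟩
    · simp
    · have : IsEmpty (ι → X) := ⟨fun x => hX.elim (x i)⟩
      simp
  have hc : (0 : ℝ) < Fintype.card X := by exact_mod_cast Fintype.card_pos
  have key : ∀ s : Finset ι,
      (Fintype.card X : ℝ) ^ s.card * ∑ x : ι → X, ∏ i ∈ s, w i x ≤
        (Fintype.card X : ℝ) ^ Fintype.card ι := by
    intro s
    refine Finset.induction_on_max_value r s ?_ ?_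
    · simp
    · intro a s ha hmax ih
      rw [Finset.card_insert_of_notMem ha, pow_succ, mul_assoc, ← sum_sum_update a]
      refine le_trans (mul_le_mul_of_nonneg_left ?_ (by positivity)) ih
      rw [Finset.sum_comm]
      refine Finset.sum_le_sum fun x _ => ?_
      have : ∀ y, ∏ i ∈ insert a s, w i (Function.update x a y)
          = w a (Function.update x a y) * ∏ i ∈ s, w i x := by
        intro y
        rw [Finset.prod_insert ha]
        congr 1
        refine Finset.prod_congr rfl fun i hi => ?_
        exact hdep i a x y (fun h => ha (h ▸ hi)) (hmax i hi)
      simp only [this, ← Finset.sum_mul]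
      exact mul_le_of_le_one_left (Finset.prod_nonneg fun i _ => hw i x) (hsum a x)
  have := key Finset.univ
  rw [Finset.card_univ] at this
  exact le_of_mul_le_mul_left (by simpa using this) (pow_pos hc (Fintype.card ι))

section Deterministic

variable {A B C : Type*} [Fintype B] [Fintype C] {t M : ℕ}

/-- The pairs that form a triangle with `f s` and avoid the pairs `x s'` for all `s'` whose root
`f s'` lies in an earlier block of `τ` than `f s`. -/
def available (Tr : A → B → C → Prop) (f : Fin t → A) (x : Fin t → B × C) (τ : A → Fin M)
    (s : Fin t) : Finset (B × C) :=
  open Classical in Finset.univ.filter fun bc => Tr (f s) bc.1 bc.2 ∧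
    ∀ s', τ (f s') < τ (f s) → (x s').1 ≠ bc.1 ∧ (x s').2 ≠ bc.2

/-- The probability with which the pair `x s` is predicted: `P (f s) (x s)` if `f s` is in `Bad`
and in one of the first `E` blocks, uniform on the available pairs otherwise. -/
def prediction (Tr : A → B → C → Prop) (P : A → B × C → ℝ) (Bad : Finset A) (E : ℕ)
    (τ : A → Fin M) (f : Fin t → A) (s : Fin t) (x : Fin t → B × C) : ℝ :=
  open Classical in
  if f s ∈ Bad ∧ (τ (f s) : ℕ) < E then P (f s) (x s)
  else if x s ∈ available Tr f x τ s then ((available Tr f x τ s).card : ℝ)⁻¹ else 0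

/-- With the roots `f` fixed, the product of the predictions is a subprobability: the prediction at
`s` depends on `x s` and on pairs in strictly earlier blocks only, so the block number is a rank. -/
theorem sum_prediction_le (Tr : A → B → C → Prop) (P : A → B × C → ℝ) (Bad : Finset A) (E : ℕ)
    (τ : A → Fin M) (f : Fin t → A) (hP : ∀ a y, 0 ≤ P a y) (hP1 : ∀ a, ∑ y, P a y ≤ 1) :
    ∑ x : Fin t → B × C, ∏ s, prediction Tr P Bad E τ f s x ≤ 1 := by
  classical
  have hav : ∀ (s : Fin t) x j y, τ (f s) ≤ τ (f j) →
      available Tr f (Function.update x j y) τ s = available Tr f x τ s := by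
    intro s x j y hr
    unfold available
    ext bc
    simp only [Finset.mem_filter, Finset.mem_univ, true_and]
    refine and_congr_right fun _ => forall_congr' fun s' => imp_congr_right fun hs' => ?_
    rw [Function.update_of_ne]
    rintro rfl
    exact absurd hs' (not_lt.2 hr)
  refine sum_prod_le_one_of_rank (fun s => (τ (f s) : ℕ)) _ ?_ ?_ ?_
  · intro s x
    unfold prediction
    split_ifs
    exacts [hP _ _, by positivity, le_rfl]
  · intro s j x y hj hr
    have hr' : τ (f s) ≤ τ (f j) := hr
    unfold prediction
    rw [hav s x j y hr', Function.update_of_ne hj.symm]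
  · intro s x
    unfold prediction
    split_ifs with h
    · simpa using hP1 (f s)
    · simp only [hav s x s _ le_rfl, Function.update_self]
      rw [Finset.sum_ite_mem, Finset.univ_inter, Finset.sum_const, nsmul_eq_mul]
      exact mul_inv_le_one

/-- The logarithmic cost of the prediction of `x s`. -/
def cost (Tr : A → B → C → Prop) (P : A → B × C → ℝ) (Bad : Finset A) (E : ℕ)
    (τ : A → Fin M) (f : Fin t → A) (s : Fin t) (x : Fin t → B × C) : ℝ :=
  open Classical in
  if f s ∈ Bad ∧ (τ (f s) : ℕ) < E then -Real.log (P (f s) (x s))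
  else Real.log (available Tr f x τ s).card

/-- A labelled family of vertex-disjoint triangles `(f s, x s)` avoiding the root `u`. -/
structure IsTriangleFamily (Tr : A → B → C → Prop) (u : A) (f : Fin t → A)
    (x : Fin t → B × C) : Prop where
  inj : Function.Injective f
  ne : ∀ s, f s ≠ u
  inj_fst : Function.Injective fun s => (x s).1
  inj_snd : Function.Injective fun s => (x s).2
  tr : ∀ s, Tr (f s) (x s).1 (x s).2

theorem IsTriangleFamily.mem_available {Tr : A → B → C → Prop} {u : A} {f : Fin t → A}
    {x : Fin t → B × C} (h : IsTriangleFamily Tr u f x) (τ : A → Fin M) (s : Fin t) :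
    x s ∈ available Tr f x τ s := by
  classical
  simp only [available, Finset.mem_filter, Finset.mem_univ, true_and]
  refine ⟨h.tr s, fun s' hs' => ?_⟩
  have hne : s' ≠ s := by rintro rfl; exact lt_irrefl _ hs'
  exact ⟨fun e => hne (h.inj_fst e), fun e => hne (h.inj_snd e)⟩

/-- The entropy bound for a fixed block assignment `τ`: reveal the roots first, at the cost of a
falling factorial, and then the triangles block by block. -/
theorem card_mul_log_card_le_sum_cost [Fintype A] (Tr : A → B → C → Prop)
    (P : A → B × C → ℝ) (Bad : Finset A) (E : ℕ) (τ : A → Fin M) (u : A)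
    (hP : ∀ a y, 0 ≤ P a y) (hP1 : ∀ a, ∑ y, P a y ≤ 1)
    (Ψ : Finset ((Fin t → A) × (Fin t → B × C)))
    (hΨ : ∀ ψ ∈ Ψ, IsTriangleFamily Tr u ψ.1 ψ.2)
    (hpos : ∀ ψ ∈ Ψ, ∀ s, ψ.1 s ∈ Bad → 0 < P (ψ.1 s) (ψ.2 s))
    (ht : t < Fintype.card A) :
    (Ψ.card : ℝ) * Real.log Ψ.card ≤
      Ψ.card * Real.log ((Fintype.card A - 1).descFactorial t) +
        ∑ ψ ∈ Ψ, ∑ s, cost Tr P Bad E τ ψ.1 s ψ.2 := by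
  classical
  have hK : (0 : ℝ) < ((Fintype.card A - 1).descFactorial t : ℝ) := by
    have : 0 < (Fintype.card A - 1).descFactorial t := Nat.descFactorial_pos.2 (by omega)
    exact_mod_cast this
  have hw0 : ∀ (f : Fin t → A) s x, 0 ≤ prediction Tr P Bad E τ f s x := by
    intro f s x
    unfold prediction
    split_ifs
    exacts [hP _ _, by positivity, le_rfl]
  have hlog : ∀ ψ ∈ Ψ, ∀ s, 0 < prediction Tr P Bad E τ ψ.1 s ψ.2 ∧
      -Real.log (prediction Tr P Bad E τ ψ.1 s ψ.2) = cost Tr P Bad E τ ψ.1 s ψ.2 := by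
    intro ψ hψ s
    unfold prediction cost
    have hm := (hΨ ψ hψ).mem_available τ s
    split_ifs with h
    · exact ⟨hpos ψ hψ s h.1, rfl⟩
    · refine ⟨?_, by rw [Real.log_inv, neg_neg]⟩
      have := Finset.card_pos.2 ⟨_, hm⟩
      positivity
  have h := card_mul_log_card_le Ψ (fun ψ => ∏ s, prediction Tr P Bad E τ ψ.1 s ψ.2) _ hK
    (fun ψ hψ => Finset.prod_pos fun s _ => (hlog ψ hψ s).1) ?_
  · refine h.trans_eq ?_
    congr 1
    refine Finset.sum_congr rfl fun ψ hψ => ?_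
    rw [Real.log_prod (fun s _ => (hlog ψ hψ s).1.ne'), ← Finset.sum_neg_distrib]
    exact Finset.sum_congr rfl fun s _ => (hlog ψ hψ s).2
  · let F : Finset (Fin t → A) := Finset.univ.filter fun f => Function.Injective f ∧ ∀ s, f s ≠ u
    have hF : F.card = (Fintype.card A - 1).descFactorial t := by
      have e : {f : Fin t → A // Function.Injective f ∧ ∀ s, f s ≠ u} ≃
          (Fin t ↪ {a : A // a ≠ u}) :=
        { toFun := fun f => ⟨fun s => ⟨f.1 s, f.2.2 s⟩, fun a b hab =>
            f.2.1 (by simpa using hab)⟩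
          invFun := fun g => ⟨fun s => (g s).1, fun a b hab => g.injective (Subtype.ext hab),
            fun s => (g s).2⟩
          left_inv := fun f => rfl
          right_inv := fun g => rfl }
      have h1 := Fintype.card_congr e
      rw [Fintype.card_embedding_eq, Fintype.card_subtype, Fintype.card_fin,
        Fintype.card_subtype_compl, Fintype.card_subtype_eq] at h1
      exact h1
    calc ∑ ψ ∈ Ψ, ∏ s, prediction Tr P Bad E τ ψ.1 s ψ.2
        ≤ ∑ ψ ∈ F ×ˢ Finset.univ, ∏ s, prediction Tr P Bad E τ ψ.1 s ψ.2 := by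
          refine Finset.sum_le_sum_of_subset_of_nonneg ?_ fun ψ _ _ =>
            Finset.prod_nonneg fun s _ => hw0 _ _ _
          intro ψ hψ
          simp only [F, Finset.mem_product, Finset.mem_filter, Finset.mem_univ, true_and, and_true]
          exact ⟨(hΨ ψ hψ).inj, (hΨ ψ hψ).ne⟩
      _ = ∑ f ∈ F, ∑ x, ∏ s, prediction Tr P Bad E τ f s x := by
          rw [Finset.sum_product]
      _ ≤ ∑ f ∈ F, (1 : ℝ) :=
          Finset.sum_le_sum fun f _ => sum_prediction_le Tr P Bad E τ f hP hP1
      _ = _ := by simp [hF]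

/-- The number of block assignments that put neither of two roots into a block before `k`. -/
theorem card_filter_block_eq [Fintype A] [DecidableEq A] (hM : 0 < M) (k : Fin M) {a b : A}
    (hab : a ≠ b) :
    (((Finset.univ : Finset (A → Fin M)).filter fun τ => k ≤ τ a ∧ k ≤ τ b).card : ℝ) =
      (M : ℝ) ^ Fintype.card A * (((M : ℝ) - k) / M) ^ 2 := by
  have h1 : ((Finset.univ : Finset (A → Fin M)).filter fun τ => k ≤ τ a ∧ k ≤ τ b) =
      Fintype.piFinset fun c => if c = a ∨ c = b then Finset.Ici k else Finset.univ := by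
    ext τ
    simp only [Finset.mem_filter, Finset.mem_univ, true_and, Fintype.mem_piFinset]
    constructor
    · rintro ⟨ha, hb⟩ c
      split_ifs with hc
      · rcases hc with rfl | rfl <;> simpa
      · simp
    · intro h
      exact ⟨by simpa using h a, by simpa using h b⟩
  have hM' : (M : ℝ) ≠ 0 := by positivity
  have h2 : ∀ c : A, (((if c = a ∨ c = b then Finset.Ici k else Finset.univ : Finset (Fin M)).card
      : ℕ) : ℝ) = (M : ℝ) * ((if c = a then ((M : ℝ) - k) / M else 1) *
        (if c = b then ((M : ℝ) - k) / M else 1)) := by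
    intro c
    have hk : ((M - (k : ℕ) : ℕ) : ℝ) = (M : ℝ) - k := by
      rw [Nat.cast_sub k.2.le]
    by_cases hca : c = a
    · subst hca
      simp only [true_or, if_true, hab, if_false, Fin.card_Ici, hk]
      field_simp
    · by_cases hcb : c = b
      · subst hcb
        simp only [or_true, if_true, hca, if_false, Fin.card_Ici, hk]
        field_simp
      · simp [hca, hcb]
  rw [h1, Fintype.card_piFinset, Nat.cast_prod, Finset.prod_congr rfl fun c _ => h2 c,
    Finset.prod_mul_distrib, Finset.prod_mul_distrib]
  simp [sq]

/-- The pairs forming a triangle with `a`. -/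
def trianglePairs (Tr : A → B → C → Prop) (a : A) : Finset (B × C) :=
  open Classical in Finset.univ.filter fun bc => Tr a bc.1 bc.2

/-- The pairs forming a triangle with `f s` whose two vertices do not lie in two distinct triangles
of the family, both different from the one at `f s`. -/
def entangledPairs (Tr : A → B → C → Prop) (f : Fin t → A) (x : Fin t → B × C) (s : Fin t) :
    Finset (B × C) :=
  open Classical in (trianglePairs Tr (f s)).filter fun bc =>
    ¬ ∃ i j, i ≠ s ∧ j ≠ s ∧ i ≠ j ∧ (x i).1 = bc.1 ∧ (x j).2 = bc.2

/-- If `f s` lies in block `k`, a pair from two other triangles of the family is available with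
probability `((M - k) / M) ^ 2`. Entangled pairs get the trivial bound `1`. -/
theorem sum_card_available_le [Fintype A] [DecidableEq A] (Tr : A → B → C → Prop) {f : Fin t → A}
    (hf : Function.Injective f) (x : Fin t → B × C) (s : Fin t) (k : Fin M) :
    ∑ τ : A → Fin M, ((available Tr f x (Function.update τ (f s) k) s).card : ℝ) ≤
      (M : ℝ) ^ Fintype.card A * ((((M : ℝ) - k) / M) ^ 2 * (trianglePairs Tr (f s)).card +
        (entangledPairs Tr f x s).card) := by
  classical
  have hM : 0 < M := k.pos
  have h1 : ∀ τ : A → Fin M,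
      ((available Tr f x (Function.update τ (f s) k) s).card : ℝ) =
      ∑ bc ∈ trianglePairs Tr (f s), if (∀ s', Function.update τ (f s) k (f s') < k →
        (x s').1 ≠ bc.1 ∧ (x s').2 ≠ bc.2) then (1 : ℝ) else 0 := by
    intro τ
    rw [Finset.sum_boole, trianglePairs, Finset.filter_filter, available]
    simp only [Function.update_self]
  have h2 : ∀ bc ∈ trianglePairs Tr (f s),
      ∑ τ : A → Fin M, (if (∀ s', Function.update τ (f s) k (f s') < k →
        (x s').1 ≠ bc.1 ∧ (x s').2 ≠ bc.2) then (1 : ℝ) else 0) ≤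
      (M : ℝ) ^ Fintype.card A * ((((M : ℝ) - k) / M) ^ 2 +
        if bc ∈ entangledPairs Tr f x s then 1 else 0) := by
    intro bc hbc
    by_cases he : bc ∈ entangledPairs Tr f x s
    · rw [if_pos he]
      calc _ ≤ ∑ τ : A → Fin M, (1 : ℝ) := by
            refine Finset.sum_le_sum fun τ _ => ?_
            split_ifs <;> norm_num
        _ = (M : ℝ) ^ Fintype.card A * 1 := by simp
        _ ≤ _ := by gcongr; nlinarith [sq_nonneg (((M : ℝ) - k) / M)]
    · rw [if_neg he, add_zero]
      have : ∃ i j, i ≠ s ∧ j ≠ s ∧ i ≠ j ∧ (x i).1 = bc.1 ∧ (x j).2 = bc.2 := by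
        by_contra hcon
        exact he (Finset.mem_filter.2 ⟨hbc, hcon⟩)
      obtain ⟨i, j, hi, hj, hij, hxi, hxj⟩ := this
      rw [← card_filter_block_eq hM k (hf.ne hij), Finset.sum_boole]
      have hsub : (Finset.univ.filter fun τ : A → Fin M => ∀ s',
          Function.update τ (f s) k (f s') < k → (x s').1 ≠ bc.1 ∧ (x s').2 ≠ bc.2) ⊆
          Finset.univ.filter fun τ : A → Fin M => k ≤ τ (f i) ∧ k ≤ τ (f j) := by
        intro τ
        simp only [Finset.mem_filter, Finset.mem_univ, true_and]
        intro h
        constructor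
        · by_contra hlt
          have := (h i (by rw [Function.update_of_ne (hf.ne hi)]; exact not_le.1 hlt)).1
          exact this hxi
        · by_contra hlt
          have := (h j (by rw [Function.update_of_ne (hf.ne hj)]; exact not_le.1 hlt)).2
          exact this hxj
      exact_mod_cast Finset.card_le_card hsub
  simp only [h1]
  rw [Finset.sum_comm]
  refine (Finset.sum_le_sum h2).trans_eq ?_
  rw [← Finset.mul_sum, Finset.sum_add_distrib, Finset.sum_const, nsmul_eq_mul, Finset.sum_boole]
  congr 2
  · ring
  · congr 2
    ext bc
    simp [entangledPairs]

/-- The average over the block assignments of the cost at `s`, split according to the block `k` of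
`f s`. The first summand is the cost of the uniform prediction, where `e` bounds the relative excess
of the number of triangles at `f s` over `T`; the second is the correction for bad roots in early
blocks. -/
theorem average_cost_le [Fintype A] [DecidableEq A] (Tr : A → B → C → Prop)
    (P : A → B × C → ℝ) (Bad : Finset A) (E : ℕ) {f : Fin t → A}
    (hf : Function.Injective f) (x : Fin t → B × C) (s : Fin t) (hM : 0 < M) {T e : ℝ} (hT : 0 < T)
    (he : 0 ≤ e) (htri : ((trianglePairs Tr (f s)).card : ℝ) ≤ (1 + e) * T)
    (hav : ∀ τ : A → Fin M, (available Tr f x τ s).Nonempty) :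
    (M : ℝ) * ∑ τ : A → Fin M, cost Tr P Bad E τ f s x ≤
      (M : ℝ) ^ Fintype.card A * ∑ k : Fin M,
        ((Real.log ((((M : ℝ) - k) / M) ^ 2) + Real.log T + e +
            (M : ℝ) ^ 2 * (entangledPairs Tr f x s).card / T) +
          open Classical in if f s ∈ Bad ∧ (k : ℕ) < E then
            -Real.log (P (f s) (x s)) - (Real.log ((((M : ℝ) - k) / M) ^ 2) + Real.log T)
          else 0) := by
  classical
  have h0 := sum_sum_update (X := Fin M) (f s) fun τ => cost Tr P Bad E τ f s x
  rw [Fintype.card_fin] at h0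
  rw [← h0, Finset.mul_sum]
  refine Finset.sum_le_sum fun k _ => ?_
  have hMr : (0 : ℝ) < M := by exact_mod_cast hM
  set y : ℝ := ((M : ℝ) - k) / M with hy
  have hk1 : (1 : ℝ) ≤ (M : ℝ) - k := by
    have : (k : ℕ) + 1 ≤ M := k.2
    have : ((k : ℕ) : ℝ) + 1 ≤ M := by exact_mod_cast this
    linarith
  have hy0 : 0 < y := by positivity
  have hy1 : 1 ≤ (M : ℝ) ^ 2 * y ^ 2 := by
    rw [← mul_pow, hy, mul_div_cancel₀ _ hMr.ne']
    nlinarith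
  have hR : (0 : ℝ) ≤ (entangledPairs Tr f x s).card := by positivity
  by_cases hb : f s ∈ Bad ∧ (k : ℕ) < E
  · have h1 : ∀ τ : A → Fin M, cost Tr P Bad E (Function.update τ (f s) k) f s x =
        -Real.log (P (f s) (x s)) := by
      intro τ
      unfold cost
      rw [Function.update_self, if_pos hb]
    simp only [h1, if_pos hb, Finset.sum_const, Finset.card_univ, nsmul_eq_mul]
    rw [Fintype.card_fun, Fintype.card_fin, Nat.cast_pow]
    gcongr
    have : 0 ≤ (M : ℝ) ^ 2 * (entangledPairs Tr f x s).card / T := by positivity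
    linarith
  · -- linearize the logarithm at `y ^ 2 * T`, so that only the mean of the cardinality matters
    have h1 : ∀ τ : A → Fin M, cost Tr P Bad E (Function.update τ (f s) k) f s x ≤
        (Real.log (y ^ 2) + Real.log T - 1) +
        ((available Tr f x (Function.update τ (f s) k) s).card : ℝ) / (y ^ 2 * T) := by
      intro τ
      unfold cost
      rw [Function.update_self, if_neg hb]
      have hc : (0 : ℝ) < (available Tr f x (Function.update τ (f s) k) s).card := by
        exact_mod_cast (hav _).card_pos
      have := Real.log_le_sub_one_of_pos (div_pos hc (by positivity : 0 < y ^ 2 * T))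
      rw [Real.log_div hc.ne' (by positivity), Real.log_mul (by positivity) hT.ne'] at this
      linarith
    refine (Finset.sum_le_sum fun τ _ => h1 τ).trans ?_
    rw [Finset.sum_add_distrib, ← Finset.sum_div, Finset.sum_const, Finset.card_univ,
      nsmul_eq_mul, Fintype.card_fun, Fintype.card_fin, Nat.cast_pow, if_neg hb, add_zero]
    have h2 := sum_card_available_le Tr hf x s k
    rw [← hy] at h2
    have h3 : (∑ τ : A → Fin M, ((available Tr f x (Function.update τ (f s) k) s).card : ℝ)) /
        (y ^ 2 * T) ≤ (M : ℝ) ^ Fintype.card A * ((1 + e) +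
          (M : ℝ) ^ 2 * (entangledPairs Tr f x s).card / T) := by
      rw [div_le_iff₀ (by positivity)]
      refine h2.trans ?_
      rw [mul_assoc]
      gcongr
      have e1 : (1 + e + (M : ℝ) ^ 2 * (entangledPairs Tr f x s).card / T) * (y ^ 2 * T) =
          y ^ 2 * ((1 + e) * T) + ((M : ℝ) ^ 2 * y ^ 2) * (entangledPairs Tr f x s).card := by
        field_simp
      rw [e1]
      gcongr
      exact le_mul_of_one_le_left hR hy1
    refine (add_le_add_right h3 _).trans_eq ?_
    ring

theorem card_filter_forall_ne {Y : Type*} [Fintype Y] [DecidableEq Y] {g : Fin t → Y}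
    (hg : Function.Injective g) :
    ((Finset.univ.filter fun y : Y => ∀ i, g i ≠ y).card : ℝ) = (Fintype.card Y : ℝ) - t := by
  have e1 : (Finset.univ.filter fun y : Y => ∀ i, g i ≠ y) = (Finset.univ.image g)ᶜ := by
    ext y; simp
  rw [e1, Finset.card_compl, Finset.card_image_of_injective _ hg, Finset.card_univ,
    Fintype.card_fin, Nat.cast_sub]
  simpa using Fintype.card_le_of_injective _ hg

/-- Summed over the family, entangled pairs are negligible: such a pair uses a vertex missed by the
family, a vertex of the triangle at the root, or an edge of the family. -/
theorem sum_card_entangledPairs_le [Fintype A] {Tr : A → B → C → Prop} {u : A} {f : Fin t → A}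
    {x : Fin t → B × C} (h : IsTriangleFamily Tr u f x) {n : ℕ} (hB : Fintype.card B = n)
    (hC : Fintype.card C = n) {c D : ℝ}
    (hdegB : ∀ b, (open Classical in Finset.univ.filter fun z : A × C => Tr z.1 b z.2).card ≤ D)
    (hdegC : ∀ b, (open Classical in Finset.univ.filter fun z : A × B => Tr z.1 z.2 b).card ≤ D)
    (hAB : ∀ a b, (open Classical in Finset.univ.filter fun z : C => Tr a b z).card ≤ c)
    (hAC : ∀ a b, (open Classical in Finset.univ.filter fun z : B => Tr a z b).card ≤ c)
    (hBC : ∀ a b, (open Classical in Finset.univ.filter fun z : A => Tr z a b).card ≤ c) :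
    ∑ s, ((entangledPairs Tr f x s).card : ℝ) ≤ 3 * t * c + 2 * ((n : ℝ) - t) * D := by
  classical
  -- the five kinds of entangled pairs, and the number of pairs of each kind
  let X1 : Fin t → Finset (B × C) := fun s =>
    (trianglePairs Tr (f s)).filter fun bc => ∀ i, (x i).1 ≠ bc.1
  let X2 : Fin t → Finset (B × C) := fun s =>
    (trianglePairs Tr (f s)).filter fun bc => ∀ i, (x i).2 ≠ bc.2
  let X3 : Fin t → Finset (B × C) := fun s =>
    (Finset.univ.filter fun z : C => Tr (f s) (x s).1 z).image fun z => ((x s).1, z)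
  let X4 : Fin t → Finset (B × C) := fun s =>
    (Finset.univ.filter fun z : B => Tr (f s) z (x s).2).image fun z => (z, (x s).2)
  let X5 : Fin t → Finset (B × C) := fun s =>
    (Finset.univ.filter fun i : Fin t => Tr (f s) (x i).1 (x i).2).image x
  have hcover : ∀ s, entangledPairs Tr f x s ⊆ (((X1 s ∪ X2 s) ∪ X3 s) ∪ X4 s) ∪ X5 s := by
    intro s bc hbc
    obtain ⟨hbc, hno⟩ := Finset.mem_filter.1 hbc
    have htr : Tr (f s) bc.1 bc.2 := (Finset.mem_filter.1 hbc).2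
    simp only [Finset.mem_union]
    by_cases h1 : ∀ i, (x i).1 ≠ bc.1
    · exact .inl (.inl (.inl (.inl (Finset.mem_filter.2 ⟨hbc, h1⟩))))
    by_cases h2 : ∀ i, (x i).2 ≠ bc.2
    · exact .inl (.inl (.inl (.inr (Finset.mem_filter.2 ⟨hbc, h2⟩))))
    push Not at h1 h2
    obtain ⟨i, hi⟩ := h1
    obtain ⟨j, hj⟩ := h2
    by_cases his : i = s
    · subst his
      exact .inl (.inl (.inr (Finset.mem_image.2 ⟨bc.2, by simpa [hi] using htr, by simp [hi]⟩)))
    by_cases hjs : j = s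
    · subst hjs
      exact .inl (.inr (Finset.mem_image.2 ⟨bc.1, by simpa [hj] using htr, by simp [hj]⟩))
    by_cases hij : i = j
    · subst hij
      exact .inr (Finset.mem_image.2 ⟨i, by simpa [hi, hj] using htr, Prod.ext hi hj⟩)
    · exact absurd ⟨i, j, his, hjs, hij, hi, hj⟩ hno
  have b1 : ∑ s, ((X1 s).card : ℝ) ≤ ((n : ℝ) - t) * D := by
    let U := Finset.univ.filter fun b : B => ∀ i, (x i).1 ≠ b
    have hU : (U.card : ℝ) = (n : ℝ) - t := by rw [← hB]; exact card_filter_forall_ne h.inj_fst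
    have e1 : ∑ s, (X1 s).card ≤
        ∑ b ∈ U, (Finset.univ.filter fun z : A × C => Tr z.1 b z.2).card := by
      rw [← Finset.card_sigma, ← Finset.card_sigma]
      refine Finset.card_le_card_of_injOn (fun z => ⟨z.2.1, (f z.1, z.2.2)⟩) ?_ ?_
      · rintro ⟨s, bc⟩ hz
        simp only [X1, U, trianglePairs, Finset.coe_sigma, Set.mem_sigma_iff, Finset.coe_filter,
          Finset.mem_filter, Finset.mem_univ, true_and, Set.mem_ofPred_eq] at hz ⊢
        exact ⟨hz.2.2, hz.2.1⟩
      · rintro ⟨s, bc⟩ - ⟨s', bc'⟩ - he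
        simp only [Sigma.mk.injEq, heq_eq_eq, Prod.mk.injEq] at he
        obtain ⟨e1, e2, e3⟩ := he
        obtain rfl := h.inj e2
        simp [Prod.ext_iff, e1, e3]
    calc ∑ s, ((X1 s).card : ℝ) ≤
          ∑ b ∈ U, ((Finset.univ.filter fun z : A × C => Tr z.1 b z.2).card : ℝ) := by exact_mod_cast e1
      _ ≤ ∑ b ∈ U, D := by
          exact Finset.sum_le_sum fun b _ => hdegB b
      _ = _ := by rw [Finset.sum_const, nsmul_eq_mul, hU]
  have b2 : ∑ s, ((X2 s).card : ℝ) ≤ ((n : ℝ) - t) * D := by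
    let U := Finset.univ.filter fun b : C => ∀ i, (x i).2 ≠ b
    have hU : (U.card : ℝ) = (n : ℝ) - t := by rw [← hC]; exact card_filter_forall_ne h.inj_snd
    have e1 : ∑ s, (X2 s).card ≤
        ∑ b ∈ U, (Finset.univ.filter fun z : A × B => Tr z.1 z.2 b).card := by
      rw [← Finset.card_sigma, ← Finset.card_sigma]
      refine Finset.card_le_card_of_injOn (fun z => ⟨z.2.2, (f z.1, z.2.1)⟩) ?_ ?_
      · rintro ⟨s, bc⟩ hz
        simp only [X2, U, trianglePairs, Finset.coe_sigma, Set.mem_sigma_iff, Finset.coe_filter,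
          Finset.mem_filter, Finset.mem_univ, true_and, Set.mem_ofPred_eq] at hz ⊢
        exact ⟨hz.2.2, hz.2.1⟩
      · rintro ⟨s, bc⟩ - ⟨s', bc'⟩ - he
        simp only [Sigma.mk.injEq, heq_eq_eq, Prod.mk.injEq] at he
        obtain ⟨e1, e2, e3⟩ := he
        obtain rfl := h.inj e2
        simp [Prod.ext_iff, e1, e3]
    calc ∑ s, ((X2 s).card : ℝ) ≤
          ∑ b ∈ U, ((Finset.univ.filter fun z : A × B => Tr z.1 z.2 b).card : ℝ) := by exact_mod_cast e1
      _ ≤ ∑ b ∈ U, D := by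
          exact Finset.sum_le_sum fun b _ => hdegC b
      _ = _ := by rw [Finset.sum_const, nsmul_eq_mul, hU]
  have b3 : ∑ s, ((X3 s).card : ℝ) ≤ t * c := by
    have : ∀ s ∈ (Finset.univ : Finset (Fin t)), ((X3 s).card : ℝ) ≤ c := fun s _ =>
      le_trans (by exact_mod_cast Finset.card_image_le) (hAB (f s) (x s).1)
    simpa using Finset.sum_le_sum this
  have b4 : ∑ s, ((X4 s).card : ℝ) ≤ t * c := by
    have : ∀ s ∈ (Finset.univ : Finset (Fin t)), ((X4 s).card : ℝ) ≤ c := fun s _ =>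
      le_trans (by exact_mod_cast Finset.card_image_le) (hAC (f s) (x s).2)
    simpa using Finset.sum_le_sum this
  have b5 : ∑ s, ((X5 s).card : ℝ) ≤ t * c := by
    have e1 : ∑ s, (X5 s).card ≤
        ∑ i : Fin t, (Finset.univ.filter fun a : A => Tr a (x i).1 (x i).2).card := by
      calc ∑ s, (X5 s).card
          ≤ ∑ s, (Finset.univ.filter fun i : Fin t => Tr (f s) (x i).1 (x i).2).card :=
            Finset.sum_le_sum fun s _ => Finset.card_image_le
        _ = ∑ i : Fin t, (Finset.univ.filter fun s : Fin t => Tr (f s) (x i).1 (x i).2).card := by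
            simp only [Finset.card_filter]
            exact Finset.sum_comm
        _ ≤ _ := by
            refine Finset.sum_le_sum fun i _ => ?_
            refine Finset.card_le_card_of_injOn f ?_ h.inj.injOn
            intro s hs
            simpa using hs
    calc ∑ s, ((X5 s).card : ℝ) ≤
          ∑ i : Fin t, ((Finset.univ.filter fun a : A => Tr a (x i).1 (x i).2).card : ℝ) := by
            exact_mod_cast e1
      _ ≤ ∑ i : Fin t, c := by
          exact Finset.sum_le_sum fun b _ => hBC _ _
      _ = _ := by simp
  have hall : ∀ s, ((entangledPairs Tr f x s).card : ℝ) ≤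
      (X1 s).card + (X2 s).card + (X3 s).card + (X4 s).card + (X5 s).card := by
    intro s
    have q0 := Finset.card_le_card (hcover s)
    have q1 := Finset.card_union_le (((X1 s ∪ X2 s) ∪ X3 s) ∪ X4 s) (X5 s)
    have q2 := Finset.card_union_le ((X1 s ∪ X2 s) ∪ X3 s) (X4 s)
    have q3 := Finset.card_union_le (X1 s ∪ X2 s) (X3 s)
    have q4 := Finset.card_union_le (X1 s) (X2 s)
    exact_mod_cast (by omega : (entangledPairs Tr f x s).card ≤
      (X1 s).card + (X2 s).card + (X3 s).card + (X4 s).card + (X5 s).card)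
  refine (Finset.sum_le_sum fun s _ => hall s).trans ?_
  simp only [Finset.sum_add_distrib]
  linarith

end Deterministic

section Deterministic

variable {A B C : Type*} {t M : ℕ}

/-- At most `|A| - t` elements of `Bad` are missed by the roots. -/
theorem card_sub_le_card_filter_mem [Fintype A] [DecidableEq A] {f : Fin t → A}
    (hf : Function.Injective f) (Bad : Finset A) :
    (Bad.card : ℝ) - ((Fintype.card A : ℝ) - t) ≤
      (Finset.univ.filter fun s => f s ∈ Bad).card := by
  have h1 : Bad ⊆ (Finset.univ.filter fun s => f s ∈ Bad).image f ∪
      Finset.univ.filter fun a => ∀ i, f i ≠ a := by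
    intro a ha
    by_cases h : ∀ i, f i ≠ a
    · simp [h]
    · push Not at h
      obtain ⟨i, rfl⟩ := h
      exact Finset.mem_union_left _ (Finset.mem_image_of_mem _ (by simpa using ha))
  have h2 := (Finset.card_le_card h1).trans (Finset.card_union_le _ _)
  rw [Finset.card_image_of_injective _ hf] at h2
  have h3 := card_filter_forall_ne hf
  have h4 : (Bad.card : ℝ) ≤ (Finset.univ.filter fun s => f s ∈ Bad).card +
      (Finset.univ.filter fun a => ∀ i, f i ≠ a).card := by exact_mod_cast h2
  linarith

/-- The gain from the bad roots in one early block: `y` is the logarithm of the squared fraction of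
roots not yet processed, `l` the benchmark. -/
theorem sum_bad_gain_le [Fintype A] [DecidableEq A] {P : A → B × C → ℝ} {Bad : Finset A}
    {β l y : ℝ} (hβ : 0 ≤ β) (hy : -(β / 2) ≤ y)
    (Ψ : Finset ((Fin t → A) × (Fin t → B × C))) (hΨ : ∀ ψ ∈ Ψ, Function.Injective ψ.1)
    (hbad : ∀ a ∈ Bad, ∑ ψ ∈ Ψ, ∑ s, (if ψ.1 s = a then -Real.log (P a (ψ.2 s)) else 0) ≤
      (l - β) * ∑ ψ ∈ Ψ, ∑ s, if ψ.1 s = a then (1 : ℝ) else 0) :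
    ∑ ψ ∈ Ψ, ∑ s, (if ψ.1 s ∈ Bad then -Real.log (P (ψ.1 s) (ψ.2 s)) - (y + l) else 0) ≤
      -(β / 2) * (Ψ.card * ((Bad.card : ℝ) - ((Fintype.card A : ℝ) - t))) := by
  have hsplit : ∀ (g : A → (Fin t → A) × (Fin t → B × C) → Fin t → ℝ),
      ∑ ψ ∈ Ψ, ∑ s, (if ψ.1 s ∈ Bad then g (ψ.1 s) ψ s else 0) =
        ∑ a ∈ Bad, ∑ ψ ∈ Ψ, ∑ s, if ψ.1 s = a then g a ψ s else 0 := by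
    intro g
    symm
    rw [Finset.sum_comm]
    refine Finset.sum_congr rfl fun ψ _ => ?_
    rw [Finset.sum_comm]
    exact Finset.sum_congr rfl fun s _ => (Finset.sum_ite_eq Bad (ψ.1 s) fun a => g a ψ s)
  have hcount : ∑ ψ ∈ Ψ, ∑ s, (if ψ.1 s ∈ Bad then (1 : ℝ) else 0) ≥
      Ψ.card * ((Bad.card : ℝ) - ((Fintype.card A : ℝ) - t)) := by
    rw [← nsmul_eq_mul, ← Finset.sum_const]
    refine Finset.sum_le_sum fun ψ hψ => ?_
    rw [Finset.sum_boole]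
    exact card_sub_le_card_filter_mem (hΨ ψ hψ) Bad
  rw [hsplit fun a ψ s => -Real.log (P a (ψ.2 s)) - (y + l)]
  rw [hsplit fun _ _ _ => 1] at hcount
  calc _ ≤ ∑ a ∈ Bad, -(β / 2) * ∑ ψ ∈ Ψ, ∑ s, (if ψ.1 s = a then (1 : ℝ) else 0) := by
        refine Finset.sum_le_sum fun a ha => ?_
        have h1 : ∑ ψ ∈ Ψ, ∑ s, (if ψ.1 s = a then -Real.log (P a (ψ.2 s)) - (y + l) else 0) =
            ∑ ψ ∈ Ψ, ∑ s, (if ψ.1 s = a then -Real.log (P a (ψ.2 s)) else 0) -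
              (y + l) * ∑ ψ ∈ Ψ, ∑ s, if ψ.1 s = a then (1 : ℝ) else 0 := by
          simp only [Finset.mul_sum, ← Finset.sum_sub_distrib]
          refine Finset.sum_congr rfl fun ψ _ => Finset.sum_congr rfl fun s _ => ?_
          split_ifs <;> ring
        have h2 : (0 : ℝ) ≤ ∑ ψ ∈ Ψ, ∑ s, if ψ.1 s = a then (1 : ℝ) else 0 :=
          Finset.sum_nonneg fun ψ _ => Finset.sum_nonneg fun s _ => by split_ifs <;> norm_num
        rw [h1]
        nlinarith [hbad a ha]
    _ = -(β / 2) * ∑ a ∈ Bad, ∑ ψ ∈ Ψ, ∑ s, (if ψ.1 s = a then (1 : ℝ) else 0) := by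
        rw [Finset.mul_sum]
    _ ≤ _ := by nlinarith

variable [Fintype B] [Fintype C]

/-- The entropy bound on the number of triangle families. The average over `k` of
`log (((M - k) / M) ^ 2)` is close to `-2` for large `M`, so the benchmark is `t (log T - 2)`; each
bad root in excess of the `n - t` roots that may be missed loses `β / 2 * (E / M)`. -/
theorem log_card_le_of_bad [Fintype A] {Tr : A → B → C → Prop} {P : A → B × C → ℝ}
    {Bad : Finset A} {E n : ℕ} {u : A} (hP : ∀ a y, 0 ≤ P a y) (hP1 : ∀ a, ∑ y, P a y ≤ 1)
    (Ψ : Finset ((Fin t → A) × (Fin t → B × C))) (hne : Ψ.Nonempty)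
    (hΨ : ∀ ψ ∈ Ψ, IsTriangleFamily Tr u ψ.1 ψ.2)
    (hpos : ∀ ψ ∈ Ψ, ∀ s, ψ.1 s ∈ Bad → 0 < P (ψ.1 s) (ψ.2 s))
    (hA : Fintype.card A = n) (hB : Fintype.card B = n) (hC : Fintype.card C = n) (ht : t < n)
    {c D T β δ : ℝ} {e : A → ℝ} (hT : 0 < T) (hβ : 0 ≤ β) (he : ∀ a, 0 ≤ e a) (hM : 0 < M)
    (hEM : E ≤ M) (hsum : ∑ a, e a ≤ δ)
    (htri : ∀ a, ((trianglePairs Tr a).card : ℝ) ≤ (1 + e a) * T)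
    (hdegB : ∀ b, (open Classical in Finset.univ.filter fun z : A × C => Tr z.1 b z.2).card ≤ D)
    (hdegC : ∀ b, (open Classical in Finset.univ.filter fun z : A × B => Tr z.1 z.2 b).card ≤ D)
    (hAB : ∀ a b, (open Classical in Finset.univ.filter fun z : C => Tr a b z).card ≤ c)
    (hAC : ∀ a b, (open Classical in Finset.univ.filter fun z : B => Tr a z b).card ≤ c)
    (hBC : ∀ a b, (open Classical in Finset.univ.filter fun z : A => Tr z a b).card ≤ c)
    (hE : ∀ k : Fin M, (k : ℕ) < E → -(β / 2) ≤ Real.log ((((M : ℝ) - k) / M) ^ 2))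
    (hbad : ∀ a ∈ Bad, ∑ ψ ∈ Ψ, ∑ s, (open Classical in if ψ.1 s = a then
      -Real.log (P a (ψ.2 s)) else 0) ≤
      (Real.log T - β) * ∑ ψ ∈ Ψ, ∑ s, open Classical in if ψ.1 s = a then (1 : ℝ) else 0) :
    Real.log Ψ.card ≤ Real.log ((n - 1).descFactorial t) +
      t * (Real.log T + (∑ k : Fin M, Real.log ((((M : ℝ) - k) / M) ^ 2)) / M) + δ +
      (M : ℝ) ^ 2 * (3 * t * c + 2 * ((n : ℝ) - t) * D) / T -
      β / 2 * (E / M) * ((Bad.card : ℝ) - ((n : ℝ) - t)) := by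
  classical
  have hMr : (0 : ℝ) < M := by exact_mod_cast hM
  have hN : (0 : ℝ) < Ψ.card := by exact_mod_cast hne.card_pos
  set N : ℝ := (Ψ.card : ℝ) with hNdef
  set K : ℝ := Real.log ((n - 1).descFactorial t) with hK
  set Y : Fin M → ℝ := fun k => Real.log ((((M : ℝ) - k) / M) ^ 2) with hY
  set R : ℝ := (3 * t * c + 2 * ((n : ℝ) - t) * D) with hR
  have h1 : ∀ τ : A → Fin M, N * Real.log N - N * K ≤
      ∑ ψ ∈ Ψ, ∑ s, cost Tr P Bad E τ ψ.1 s ψ.2 := by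
    intro τ
    have := card_mul_log_card_le_sum_cost Tr P Bad E τ u hP hP1 Ψ hΨ hpos (by rwa [hA])
    rw [hA] at this
    linarith
  let base : (Fin t → A) × (Fin t → B × C) → Fin t → Fin M → ℝ := fun ψ s k =>
    Y k + Real.log T + e (ψ.1 s) + (M : ℝ) ^ 2 * (entangledPairs Tr ψ.1 ψ.2 s).card / T
  let gain : (Fin t → A) × (Fin t → B × C) → Fin t → Fin M → ℝ := fun ψ s k =>
    if ψ.1 s ∈ Bad ∧ (k : ℕ) < E then
      -Real.log (P (ψ.1 s) (ψ.2 s)) - (Y k + Real.log T) else 0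
  have h2 : (M : ℝ) * (N * Real.log N - N * K) ≤
      ∑ ψ ∈ Ψ, ∑ s, ∑ k : Fin M, (base ψ s k + gain ψ s k) := by
    have hpow : (0 : ℝ) < (M : ℝ) ^ Fintype.card A := by positivity
    refine le_of_mul_le_mul_left ?_ hpow
    calc (M : ℝ) ^ Fintype.card A * ((M : ℝ) * (N * Real.log N - N * K))
        = (M : ℝ) * ∑ τ : A → Fin M, (N * Real.log N - N * K) := by
          simp only [Finset.sum_const, Finset.card_univ, Fintype.card_fun, Fintype.card_fin,
            nsmul_eq_mul, Nat.cast_pow]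
          ring
      _ ≤ (M : ℝ) * ∑ τ : A → Fin M, ∑ ψ ∈ Ψ, ∑ s, cost Tr P Bad E τ ψ.1 s ψ.2 := by
          gcongr with τ
          exact h1 τ
      _ = ∑ ψ ∈ Ψ, ∑ s, (M : ℝ) * ∑ τ : A → Fin M, cost Tr P Bad E τ ψ.1 s ψ.2 := by
          simp only [Finset.mul_sum]
          rw [Finset.sum_comm]
          exact Finset.sum_congr rfl fun ψ _ => Finset.sum_comm
      _ ≤ ∑ ψ ∈ Ψ, ∑ s, (M : ℝ) ^ Fintype.card A *
            ∑ k : Fin M, (base ψ s k + gain ψ s k) := by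
          refine Finset.sum_le_sum fun ψ hψ => Finset.sum_le_sum fun s _ => ?_
          exact average_cost_le Tr P Bad E (hΨ ψ hψ).inj ψ.2 s hM hT (he _) (htri _)
            fun τ => ⟨_, (hΨ ψ hψ).mem_available τ s⟩
      _ = _ := by simp only [Finset.mul_sum]
  have hbase : ∀ ψ ∈ Ψ, ∑ s, ∑ k : Fin M, base ψ s k ≤
      t * (∑ k, Y k) + M * (t * Real.log T) + M * δ + M * ((M : ℝ) ^ 2 * R / T) := by
    intro ψ hψ
    have e1 : ∑ s, ∑ k : Fin M, base ψ s k = t * (∑ k, Y k) + M * (t * Real.log T) +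
        M * (∑ s, e (ψ.1 s)) +
        M * ((M : ℝ) ^ 2 * (∑ s, ((entangledPairs Tr ψ.1 ψ.2 s).card : ℝ)) / T) := by
      simp only [base, Finset.sum_add_distrib, Finset.sum_const, Finset.card_univ,
        Fintype.card_fin, nsmul_eq_mul, ← Finset.mul_sum, ← Finset.sum_div]
      ring
    have e2 : ∑ s, e (ψ.1 s) ≤ δ := by
      refine le_trans ?_ hsum
      rw [← Finset.sum_image (s := Finset.univ) (g := ψ.1) (f := e)
        fun a _ b _ hab => (hΨ ψ hψ).inj hab]
      exact Finset.sum_le_sum_of_subset_of_nonneg (Finset.subset_univ _) fun a _ _ => he a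
    have e3 := sum_card_entangledPairs_le (hΨ ψ hψ) hB hC hdegB hdegC hAB hAC hBC
    rw [e1]
    gcongr
  have hgain : ∑ ψ ∈ Ψ, ∑ s, ∑ k : Fin M, gain ψ s k ≤
      E * (-(β / 2) * (N * ((Bad.card : ℝ) - ((n : ℝ) - t)))) := by
    have e1 : ∑ ψ ∈ Ψ, ∑ s, ∑ k : Fin M, gain ψ s k =
        ∑ k : Fin M, ∑ ψ ∈ Ψ, ∑ s, gain ψ s k := by
      symm
      rw [Finset.sum_comm]
      exact Finset.sum_congr rfl fun ψ _ => Finset.sum_comm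
    have e2 : ∀ k : Fin M, ∑ ψ ∈ Ψ, ∑ s, gain ψ s k ≤
        if (k : ℕ) < E then -(β / 2) * (N * ((Bad.card : ℝ) - ((n : ℝ) - t))) else 0 := by
      intro k
      split_ifs with hk
      · have := sum_bad_gain_le hβ (hE k hk) Ψ (fun ψ hψ => (hΨ ψ hψ).inj)
          (fun a ha => by convert hbad a ha)
        rw [hA] at this
        simpa only [gain, hk, and_true] using this
      · simp [gain, hk]
    have e3 : (Finset.univ.filter fun k : Fin M => (k : ℕ) < E).card = E := by
      rw [Fin.card_filter_val_lt, Nat.min_eq_right hEM]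
    rw [e1]
    refine (Finset.sum_le_sum fun k _ => e2 k).trans_eq ?_
    rw [← Finset.sum_filter, Finset.sum_const, e3, nsmul_eq_mul]
  have h3 : (M : ℝ) * (N * Real.log N - N * K) ≤
      N * (t * (∑ k, Y k) + M * (t * Real.log T) + M * δ + M * ((M : ℝ) ^ 2 * R / T)) +
      E * (-(β / 2) * (N * ((Bad.card : ℝ) - ((n : ℝ) - t)))) := by
    refine h2.trans ?_
    simp only [Finset.sum_add_distrib]
    refine add_le_add ?_ hgain
    rw [hNdef, ← nsmul_eq_mul, ← Finset.sum_const]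
    exact Finset.sum_le_sum hbase
  have hMN : 0 < (M : ℝ) * N := by positivity
  refine le_of_mul_le_mul_left ?_ hMN
  calc (M : ℝ) * N * Real.log N
      ≤ (M : ℝ) * N * K + (N * (t * (∑ k, Y k) + M * (t * Real.log T) + M * δ +
          M * ((M : ℝ) ^ 2 * R / T)) +
          E * (-(β / 2) * (N * ((Bad.card : ℝ) - ((n : ℝ) - t))))) := by linarith
    _ = _ := by
        field_simp
        ring

end Deterministic

/-! ### Concentration for products of Bernoulli variables -/

section Bernoulli

variable {α : Type*} [DecidableEq α]

/-- The expectation of `f` at a random subset of `E` that contains each element independently with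
probability `p`. -/
def bernoulliExpect (E : Finset α) (p : ℝ) (f : Finset α → ℝ) : ℝ :=
  ∑ S ∈ E.powerset, p ^ S.card * (1 - p) ^ (E \ S).card * f S

variable {E : Finset α} {p : ℝ}

theorem bernoulliExpect_mono (hp : 0 ≤ p) (hp1 : p ≤ 1) {f g : Finset α → ℝ}
    (h : ∀ S, S ⊆ E → f S ≤ g S) : bernoulliExpect E p f ≤ bernoulliExpect E p g := by
  have : 0 ≤ 1 - p := by linarith
  exact Finset.sum_le_sum fun S hS => mul_le_mul_of_nonneg_left (h S (Finset.mem_powerset.1 hS))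
    (by positivity)

theorem bernoulliExpect_sum {κ : Type*} (s : Finset κ) (f : κ → Finset α → ℝ) :
    bernoulliExpect E p (fun S => ∑ k ∈ s, f k S) = ∑ k ∈ s, bernoulliExpect E p (f k) := by
  simp only [bernoulliExpect, Finset.mul_sum]
  exact Finset.sum_comm

theorem bernoulliExpect_mul_const (f : Finset α → ℝ) (c : ℝ) :
    bernoulliExpect E p (fun S => f S * c) = bernoulliExpect E p f * c := by
  simp only [bernoulliExpect, Finset.sum_mul, mul_assoc]

theorem bernoulliExpect_one : bernoulliExpect E p (fun _ => 1) = 1 := by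
  have h := Finset.prod_add (fun _ : α => p) (fun _ => 1 - p) E
  simp only [Finset.prod_const, add_sub_cancel, one_pow] at h
  simp only [bernoulliExpect, mul_one]
  exact h.symm

theorem bernoulliExpect_insert {e : α} (he : e ∉ E) (f : Finset α → ℝ) :
    bernoulliExpect (insert e E) p f =
      bernoulliExpect E p fun S => (1 - p) * f S + p * f (insert e S) := by
  unfold bernoulliExpect
  rw [Finset.sum_powerset_insert he, ← Finset.sum_add_distrib]
  refine Finset.sum_congr rfl fun S hS => ?_
  have hS' := Finset.mem_powerset.1 hS
  have heS : e ∉ S := fun h => he (hS' h)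
  have h1 : insert e E \ S = insert e (E \ S) := Finset.insert_sdiff_of_notMem _ heS
  have h2 : insert e E \ insert e S = E \ S := by
    ext x
    simp only [Finset.mem_sdiff, Finset.mem_insert, not_or]
    constructor
    · rintro ⟨rfl | h, h3, h4⟩
      · exact absurd rfl h3
      · exact ⟨h, h4⟩
    · rintro ⟨h, h4⟩
      exact ⟨.inr h, fun h5 => he (h5 ▸ h), h4⟩
  rw [h1, h2, Finset.card_insert_of_notMem heS,
    Finset.card_insert_of_notMem (fun h => he (Finset.mem_sdiff.1 h).1)]
  ring

/-- `f S` does not depend on whether `e` is in `S`. -/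
def Ignores {β : Type*} (f : Finset α → β) (e : α) : Prop := ∀ S, f (insert e S) = f S

/-- Exponential tilting in one coordinate: `E[exp (w (ξ - …))] ≤ 1` for a Bernoulli variable `ξ`
independent of the weight `w` and of the factor `f`. -/
theorem bernoulliExpect_exp_coordinate_le (hp : 0 ≤ p) (hp1 : p ≤ 1) {e : α} (he : e ∈ E)
    {f w : Finset α → ℝ} (hf : ∀ S, 0 ≤ f S) (hfe : Ignores f e) (hwe : Ignores w e) :
    bernoulliExpect E p (fun S => f S *
      Real.exp ((if e ∈ S then w S else 0) - p * (Real.exp (w S) - 1))) ≤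
      bernoulliExpect E p f := by
  rw [← Finset.insert_erase he, bernoulliExpect_insert (Finset.notMem_erase _ _),
    bernoulliExpect_insert (Finset.notMem_erase _ _)]
  refine bernoulliExpect_mono hp hp1 fun S hS => ?_
  have heS : e ∉ S := fun h => Finset.notMem_erase e E (hS h)
  rw [hfe, hwe, if_neg heS, if_pos (Finset.mem_insert_self _ _)]
  set x := Real.exp (w S) - 1 with hx
  have hx' : Real.exp (w S - p * x) = (1 + x) * Real.exp (-(p * x)) := by
    rw [sub_eq_add_neg, Real.exp_add, hx]; ring
  have h1 : (1 + p * x) * Real.exp (-(p * x)) ≤ 1 := by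
    have := Real.add_one_le_exp (p * x)
    rw [Real.exp_neg, ← div_eq_mul_inv, div_le_one (Real.exp_pos _)]
    linarith
  rw [zero_sub, hx']
  calc _ = f S * ((1 + p * x) * Real.exp (-(p * x))) := by ring
    _ ≤ f S * 1 := mul_le_mul_of_nonneg_left h1 (hf S)
    _ = _ := by ring

theorem bernoulliExpect_exp_sum_le {ι : Type*} (hp : 0 ≤ p) (hp1 : p ≤ 1)
    (I : Finset ι) {φ : ι → α} (hφ : Set.InjOn φ I) (hφE : ∀ i ∈ I, φ i ∈ E)
    {f : Finset α → ℝ} {w : ι → Finset α → ℝ} (hf : ∀ S, 0 ≤ f S)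
    (hfi : ∀ i ∈ I, Ignores f (φ i)) (hw : ∀ i ∈ I, ∀ j ∈ I, Ignores (w i) (φ j)) :
    bernoulliExpect E p (fun S => f S * Real.exp (∑ i ∈ I,
      ((if φ i ∈ S then w i S else 0) - p * (Real.exp (w i S) - 1)))) ≤
      bernoulliExpect E p f := by
  classical
  induction I using Finset.induction_on with
  | empty => simp
  | insert a I ha ih =>
    have hφI : Set.InjOn φ I := hφ.mono (by simp)
    refine le_trans (le_of_eq ?_) (le_trans (bernoulliExpect_exp_coordinate_le (E := E) (p := p)
      (e := φ a) (w := w a) (f := fun S => f S * Real.exp (∑ i ∈ I,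
        ((if φ i ∈ S then w i S else 0) - p * (Real.exp (w i S) - 1)))) hp hp1
        (hφE a (Finset.mem_insert_self _ _)) ?_ ?_ ?_)
      (ih hφI (fun i hi => hφE i (Finset.mem_insert_of_mem hi))
        (fun i hi => hfi i (Finset.mem_insert_of_mem hi))
        (fun i hi j hj => hw i (Finset.mem_insert_of_mem hi) j (Finset.mem_insert_of_mem hj))))
    · congr 1
      funext S
      rw [Finset.sum_insert ha, add_comm, Real.exp_add, mul_assoc]
    · exact fun S => mul_nonneg (hf S) (Real.exp_pos _).le
    · intro S
      have e1 := hfi a (Finset.mem_insert_self _ _) S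
      simp only [e1]
      congr 2
      refine Finset.sum_congr rfl fun i hi => ?_
      have hne : φ i ≠ φ a := fun h => ha (by
        have := hφ (Finset.mem_insert_of_mem hi) (Finset.mem_insert_self _ _) h
        exact this ▸ hi)
      rw [hw i (Finset.mem_insert_of_mem hi) a (Finset.mem_insert_self _ _) S]
      simp [hne]
    · exact hw a (Finset.mem_insert_self _ _) a (Finset.mem_insert_self _ _)

/-- The probability that a random subset of `E` has the property `Q`. -/
def bernoulliProb (E : Finset α) (p : ℝ) (Q : Finset α → Prop) : ℝ :=
  open Classical in bernoulliExpect E p fun S => if Q S then 1 else 0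

theorem bernoulliProb_mono (hp : 0 ≤ p) (hp1 : p ≤ 1) {Q R : Finset α → Prop}
    (h : ∀ S, S ⊆ E → Q S → R S) : bernoulliProb E p Q ≤ bernoulliProb E p R := by
  refine bernoulliExpect_mono hp hp1 fun S hS => ?_
  have := h S hS
  split_ifs <;> simp_all

theorem bernoulliProb_exists_le (hp : 0 ≤ p) (hp1 : p ≤ 1) {κ : Type*} (s : Finset κ)
    (Q : κ → Finset α → Prop) :
    bernoulliProb E p (fun S => ∃ k ∈ s, Q k S) ≤ ∑ k ∈ s, bernoulliProb E p (Q k) := by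
  classical
  unfold bernoulliProb
  rw [← bernoulliExpect_sum]
  refine bernoulliExpect_mono hp hp1 fun S _ => ?_
  split_ifs with h
  · obtain ⟨k, hk, hQ⟩ := h
    refine le_trans ?_ (Finset.single_le_sum (fun i _ => ?_) hk)
    · simp [hQ]
    · split_ifs <;> norm_num
  · exact Finset.sum_nonneg fun i _ => by split_ifs <;> norm_num

theorem bernoulliProb_or_le (hp : 0 ≤ p) (hp1 : p ≤ 1) (Q R : Finset α → Prop) :
    bernoulliProb E p (fun S => Q S ∨ R S) ≤ bernoulliProb E p Q + bernoulliProb E p R := by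
  have := bernoulliProb_exists_le (E := E) hp hp1 Finset.univ fun b : Bool => if b then Q else R
  simpa [or_comm, add_comm] using this

/-- An upper tail bound for a weighted sum of independent Bernoulli variables, in which the weights
may depend on further coordinates: on the event that the weights are at most `v` and the
conditional mean is at most `m`, the sum exceeds its conditional mean by `2 θ m` with probability at
most `exp (-θ² m / v)`. -/
theorem bernoulliProb_sum_ge_le {ι : Type*} (hp : 0 ≤ p) (hp1 : p ≤ 1)
    (I : Finset ι) {φ : ι → α} (hφ : Set.InjOn φ I) (hφE : ∀ i ∈ I, φ i ∈ E)
    {w : ι → Finset α → ℝ} (hw0 : ∀ i S, 0 ≤ w i S)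
    (hw : ∀ i ∈ I, ∀ j ∈ I, Ignores (w i) (φ j)) {v m θ : ℝ} (hv : 0 < v) (hθ : 0 ≤ θ)
    (hθ1 : θ ≤ 1) :
    bernoulliProb E p (fun S => (∀ i ∈ I, w i S ≤ v) ∧ p * ∑ i ∈ I, w i S ≤ m ∧
      p * ∑ i ∈ I, w i S + 2 * θ * m ≤ ∑ i ∈ I, if φ i ∈ S then w i S else 0) ≤
      Real.exp (-(θ ^ 2 * m / v)) := by
  classical
  set lam := θ / v with hlam
  have hlam0 : 0 ≤ lam := by positivity
  let f : Finset α → ℝ := fun S =>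
    if (∀ i ∈ I, w i S ≤ v) ∧ p * ∑ i ∈ I, w i S ≤ m then 1 else 0
  have hf0 : ∀ S, 0 ≤ f S := fun S => by simp only [f]; split_ifs <;> norm_num
  have hf1 : ∀ S, f S ≤ 1 := fun S => by simp only [f]; split_ifs <;> norm_num
  have hfI : ∀ j ∈ I, Ignores f (φ j) := by
    intro j hj S
    have e1 : ∀ i ∈ I, w i (insert (φ j) S) = w i S := fun i hi => hw i hi j hj S
    have e2 : (∀ i ∈ I, w i (insert (φ j) S) ≤ v) ↔ ∀ i ∈ I, w i S ≤ v :=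
      forall₂_congr fun i hi => by rw [e1 i hi]
    simp only [f, e2, Finset.sum_congr rfl e1]
  have hmain := bernoulliExpect_exp_sum_le (E := E) hp hp1 I hφ hφE (f := f)
    (w := fun i S => lam * w i S) hf0 hfI
    (fun i hi j hj S => by simp only [hw i hi j hj S])
  have hone : bernoulliExpect E p f ≤ 1 :=
    (bernoulliExpect_mono hp hp1 fun S _ => hf1 S).trans_eq bernoulliExpect_one
  have hpt : ∀ S, S ⊆ E → (if (∀ i ∈ I, w i S ≤ v) ∧ p * ∑ i ∈ I, w i S ≤ m ∧
      p * ∑ i ∈ I, w i S + 2 * θ * m ≤ ∑ i ∈ I, (if φ i ∈ S then w i S else 0) then (1 : ℝ) else 0) ≤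
      (f S * Real.exp (∑ i ∈ I, ((if φ i ∈ S then lam * w i S else 0) -
        p * (Real.exp (lam * w i S) - 1)))) * Real.exp (-(θ ^ 2 * m / v)) := by
    intro S _
    split_ifs with h
    · obtain ⟨h1, h2, h3⟩ := h
      have hfS : f S = 1 := if_pos ⟨h1, h2⟩
      rw [hfS, one_mul, ← Real.exp_add]
      refine Real.one_le_exp ?_
      have h4 : ∀ i ∈ I, (if φ i ∈ S then lam * w i S else 0) - p * (lam * (1 + θ) * w i S) ≤
          (if φ i ∈ S then lam * w i S else 0) - p * (Real.exp (lam * w i S) - 1) := by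
        intro i hi
        have hx0 : 0 ≤ lam * w i S := mul_nonneg hlam0 (hw0 i S)
        have hx1 : lam * w i S ≤ θ := by
          calc lam * w i S ≤ lam * v := mul_le_mul_of_nonneg_left (h1 i hi) hlam0
            _ = θ := div_mul_cancel₀ _ hv.ne'
        have h5 := Real.abs_exp_sub_one_sub_id_le (x := lam * w i S)
          (by rw [abs_of_nonneg hx0]; linarith)
        have h6 := (abs_le.1 h5).2
        have h7 : Real.exp (lam * w i S) - 1 ≤ lam * (1 + θ) * w i S := by nlinarith
        have := mul_le_mul_of_nonneg_left h7 hp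
        linarith
      have h8 := Finset.sum_le_sum h4
      have h9 : ∑ i ∈ I, ((if φ i ∈ S then lam * w i S else 0) - p * (lam * (1 + θ) * w i S)) =
          lam * (∑ i ∈ I, (if φ i ∈ S then w i S else 0)) -
            lam * (1 + θ) * (p * ∑ i ∈ I, w i S) := by
        rw [Finset.sum_sub_distrib, Finset.mul_sum, Finset.mul_sum, Finset.mul_sum]
        congr 1
        · exact Finset.sum_congr rfl fun i _ => by split_ifs <;> simp
        · exact Finset.sum_congr rfl fun i _ => by ring
      rw [h9] at h8
      have h10 : θ ^ 2 * m / v = lam * (θ * m) := by rw [hlam]; ring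
      rw [h10]
      have h11 := mul_le_mul_of_nonneg_left h3 hlam0
      have h12 := mul_le_mul_of_nonneg_left h2 (mul_nonneg hlam0 hθ)
      linarith
    · exact mul_nonneg (mul_nonneg (hf0 S) (Real.exp_pos _).le) (Real.exp_pos _).le
  unfold bernoulliProb
  refine (bernoulliExpect_mono hp hp1 fun S hS => ?_).trans
    ((bernoulliExpect_mul_const _ _).trans_le
      (mul_le_of_le_one_left (Real.exp_pos _).le (hmain.trans hone)))
  convert hpt S hS
end Bernoulli

/-! ### Triangles and codegrees in a random subgraph -/

section RandomSubgraph

/-- Translation between the law of `Γ_p` and finite sums over subsets of the edge set of `Γ`. -/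
theorem one_sub_bernoulliProb_le_sparsification {W : Type*} [Fintype W] [DecidableEq W]
    (Γ : SimpleGraph W) [DecidableRel Γ.Adj] (p : unitInterval) (Q : Finset (Sym2 W) → Prop)
    (A : Set (SimpleGraph W))
    (hA : ∀ S : Finset (Sym2 W), S ⊆ Γ.edgeFinset → ¬ Q S →
      ∀ G : SimpleGraph W, G.edgeSet = S → G ∈ A) :
    1 - bernoulliProb Γ.edgeFinset p Q ≤ (sparsification Γ p).real A := by
  classical
  have h1 : (sparsification Γ p).real A =
      (ProbabilityTheory.setBernoulli Γ.edgeSet p).real (SimpleGraph.edgeSet '' A) := by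
    rw [sparsification, measureReal_def, measureReal_def,
      SimpleGraph.measurableEmbedding_edgeSet.comap_apply]
  let F : Finset (Finset (Sym2 W)) := Γ.edgeFinset.powerset.filter fun S => ¬ Q S
  have h2 : ((F.image fun S : Finset (Sym2 W) => (S : Set (Sym2 W)) : Finset (Set (Sym2 W))) :
      Set (Set (Sym2 W))) ⊆ SimpleGraph.edgeSet '' A := by
    intro X hX
    simp only [Finset.coe_image, Set.mem_image, F, Finset.coe_filter, Finset.mem_powerset,
      Set.mem_ofPred_eq] at hX
    obtain ⟨S, ⟨hS, hQ⟩, rfl⟩ := hX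
    have hG : (SimpleGraph.fromEdgeSet (S : Set (Sym2 W))).edgeSet = S := by
      rw [SimpleGraph.edgeSet_fromEdgeSet, sdiff_eq_left, Set.disjoint_left]
      intro e he
      have := hS he
      rw [SimpleGraph.mem_edgeFinset] at this
      exact Γ.not_isDiag_of_mem_edgeSet this
    exact ⟨_, hA S hS hQ _ hG, hG⟩
  have h3 := measureReal_mono (μ := ProbabilityTheory.setBernoulli Γ.edgeSet p) h2
  rw [h1]
  refine le_trans (le_of_eq ?_) h3
  rw [← sum_measureReal_singleton, Finset.sum_image (fun a _ b _ h => Finset.coe_injective h),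
    Finset.sum_filter]
  have h4 : ∀ S ∈ Γ.edgeFinset.powerset,
      (if ¬ Q S then (ProbabilityTheory.setBernoulli Γ.edgeSet p).real {(S : Set (Sym2 W))}
        else 0) =
      (p : ℝ) ^ S.card * (1 - p) ^ (Γ.edgeFinset \ S).card * 1 -
        (p : ℝ) ^ S.card * (1 - p) ^ (Γ.edgeFinset \ S).card * (if Q S then 1 else 0) := by
    intro S hS
    have hS' : (S : Set (Sym2 W)) ⊆ Γ.edgeSet := by
      intro e he
      simpa using Finset.mem_powerset.1 hS he
    rw [ProbabilityTheory.setBernoulli_real_singleton p hS' (Set.toFinite _),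
      Set.ncard_coe_finset]
    have : (Γ.edgeSet \ (S : Set (Sym2 W))).ncard = (Γ.edgeFinset \ S).card := by
      rw [← Set.ncard_coe_finset]
      simp
    rw [this]
    split_ifs <;> simp_all
  rw [Finset.sum_congr rfl h4, Finset.sum_sub_distrib]
  congr 1
  exact bernoulliExpect_one.symm

variable {W : Type*} [DecidableEq W] (Γ : SimpleGraph W)
  {E : Finset (Sym2 W)} {p : ℝ}

/-- Upper tail of the degree. -/
theorem bernoulliProb_degree_le (hE : ∀ e, e ∈ E ↔ e ∈ Γ.edgeSet) (hp : 0 ≤ p) (hp1 : p ≤ 1)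
    {n : ℕ} {x : W} {I : Finset W} (hI : I.card ≤ n) (hadj : ∀ a ∈ I, Γ.Adj x a) :
    bernoulliProb E p (fun S => 3 * (p * n) ≤ ((I.filter fun a => s(x, a) ∈ S).card : ℝ)) ≤
      Real.exp (-(p * n)) := by
  have h := bernoulliProb_sum_ge_le (E := E) hp hp1 I (φ := fun a => s(x, a))
    (fun a _ b _ h => Sym2.congr_right.1 h) (fun a ha => (hE _).2 (hadj a ha))
    (w := fun _ _ => 1) (fun _ _ => zero_le_one) (fun _ _ _ _ _ => rfl) (v := 1) (m := p * n)
    (θ := 1) one_pos zero_le_one le_rfl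
  simp only [one_pow, one_mul, div_one] at h
  refine (bernoulliProb_mono hp hp1 fun S _ hS => ?_).trans h
  have hI' : (I.card : ℝ) ≤ n := by exact_mod_cast hI
  have h2 : p * I.card ≤ p * n := by gcongr
  refine ⟨fun _ _ => le_rfl, by simpa using h2, ?_⟩
  rw [Finset.sum_boole]
  simp only [Finset.sum_const, nsmul_eq_mul, mul_one]
  linarith

/-- Upper tail of the codegree. -/
theorem bernoulliProb_codegree_le (hE : ∀ e, e ∈ E ↔ e ∈ Γ.edgeSet) (hp : 0 ≤ p) (hp1 : p ≤ 1)
    {n : ℕ} {x y : W} {I : Finset W} (hI : I.card ≤ n) (hxy : x ≠ y) (hx : x ∉ I) {m : ℝ}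
    (hm : 3 * p ^ 2 * n ≤ m) :
    bernoulliProb E p (fun S =>
      3 * m < ((I.filter fun a => s(x, a) ∈ S ∧ s(y, a) ∈ S).card : ℝ)) ≤
      Real.exp (-(p * n)) + Real.exp (-m) := by
  classical
  let N := I.filter fun a => Γ.Adj x a
  let J := I.filter fun a => Γ.Adj y a
  have h1 := bernoulliProb_degree_le Γ hE hp hp1 (n := n) (x := x) (I := N)
    ((Finset.card_filter_le _ _).trans hI) (fun a ha => (Finset.mem_filter.1 ha).2)
  have h2 := bernoulliProb_sum_ge_le (E := E) hp hp1 J (φ := fun a => s(y, a))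
    (fun a _ b _ h => Sym2.congr_right.1 h)
    (fun a ha => (hE _).2 (Finset.mem_filter.1 ha).2)
    (w := fun a S => if s(x, a) ∈ S then 1 else 0)
    (fun _ _ => by split_ifs <;> norm_num)
    (fun a ha b hb S => by
      have : s(x, a) ≠ s(y, b) := by
        intro h
        rcases Sym2.eq_iff.1 h with h | h
        · exact hxy h.1
        · exact hx (h.1 ▸ (Finset.mem_filter.1 hb).1)
      simp [this]) (v := 1) (m := m)
    (θ := 1) one_pos zero_le_one le_rfl
  simp only [one_pow, one_mul, div_one] at h2
  refine le_trans ?_ (add_le_add h1 h2)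
  refine le_trans (bernoulliProb_mono hp hp1 fun S hS hlt => ?_) (bernoulliProb_or_le hp hp1 _ _)
  rw [or_iff_not_imp_left]
  intro hdeg
  rw [not_le] at hdeg
  have e1 : p * ∑ a ∈ J, (if s(x, a) ∈ S then (1 : ℝ) else 0) ≤ m := by
    rw [Finset.sum_boole]
    have : ((J.filter fun a => s(x, a) ∈ S).card : ℝ) ≤
        ((N.filter fun a => s(x, a) ∈ S).card : ℝ) := by
      norm_cast
      refine Finset.card_le_card fun a ha => ?_
      simp only [J, N, Finset.mem_filter] at ha ⊢
      exact ⟨⟨ha.1.1, (hE _).1 (hS ha.2)⟩, ha.2⟩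
    calc _ ≤ p * (3 * (p * n)) := mul_le_mul_of_nonneg_left (this.trans hdeg.le) hp
      _ = 3 * p ^ 2 * n := by ring
      _ ≤ m := hm
  refine ⟨fun a _ => by split_ifs <;> norm_num, e1, ?_⟩
  have e2 : (∑ a ∈ J, if s(y, a) ∈ S then (if s(x, a) ∈ S then (1 : ℝ) else 0) else 0) =
      ((I.filter fun a => s(x, a) ∈ S ∧ s(y, a) ∈ S).card : ℝ) := by
    simp only [← ite_and]
    rw [Finset.sum_boole]
    congr 2
    ext a
    simp only [J, Finset.mem_filter]
    constructor
    · rintro ⟨⟨h1, _⟩, h2, h3⟩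
      exact ⟨h1, h3, h2⟩
    · rintro ⟨h1, h2, h3⟩
      exact ⟨⟨h1, (hE _).1 (hS h3)⟩, h3, h2⟩
  rw [e2]
  linarith

/-- Upper tail of the number of triangles at a vertex. -/
theorem bernoulliProb_triangles_le (hE : ∀ e, e ∈ E ↔ e ∈ Γ.edgeSet) (hp : 0 < p) (hp1 : p ≤ 1)
    {n : ℕ} (hn : 0 < n) {x : W} {I J : Finset W} (hI : I.card ≤ n) (hJ : J.card ≤ n)
    (hxI : x ∉ I) (hxJ : x ∉ J) (hIJ : Disjoint I J) {θ k : ℝ} (hθ : 0 < θ) (hθ1 : θ ≤ 1)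
    (hk1 : k ≤ θ ^ 2 * (p * n)) (hk2 : k ≤ θ ^ 2 * (p ^ 3 * n ^ 2)) :
    bernoulliProb E p (fun S =>
      p ^ 3 * (open Classical in ((I ×ˢ J).filter fun z =>
        Γ.Adj x z.1 ∧ Γ.Adj x z.2 ∧ Γ.Adj z.1 z.2).card : ℝ) + 26 * θ * (p ^ 3 * n ^ 2) <
      (((I ×ˢ J).filter fun z => s(x, z.1) ∈ S ∧ s(x, z.2) ∈ S ∧ s(z.1, z.2) ∈ S).card : ℝ)) ≤
      4 * Real.exp (-k) := by
  classical
  have hn' : (0 : ℝ) < n := by exact_mod_cast hn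
  let A := I.filter fun a => Γ.Adj x a
  let B := J.filter fun b => Γ.Adj x b
  have hAn : (A.card : ℝ) ≤ n := by exact_mod_cast (Finset.card_filter_le _ _).trans hI
  have hBn : (B.card : ℝ) ≤ n := by exact_mod_cast (Finset.card_filter_le _ _).trans hJ
  have hAI : ∀ a ∈ A, a ∈ I ∧ Γ.Adj x a := fun a ha => Finset.mem_filter.1 ha
  have hBJ : ∀ a ∈ B, a ∈ J ∧ Γ.Adj x a := fun a ha => Finset.mem_filter.1 ha
  have hne : ∀ a ∈ A, ∀ b ∈ B, a ≠ b := fun a ha b hb h =>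
    Finset.disjoint_left.1 hIJ (hAI a ha).1 (h ▸ (hBJ b hb).1)
  let K := (A ×ˢ B).filter fun z => Γ.Adj z.1 z.2
  have hK : ∀ z ∈ K, z.1 ∈ A ∧ z.2 ∈ B ∧ Γ.Adj z.1 z.2 := fun z hz => by
    simpa [K, and_assoc] using hz
  let w1 : W → Finset (Sym2 W) → ℝ := fun a _ => ∑ b ∈ B, if Γ.Adj a b then 1 else 0
  let w2 : W → Finset (Sym2 W) → ℝ := fun b S =>
    ∑ a ∈ A, if s(x, a) ∈ S ∧ Γ.Adj a b then 1 else 0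
  let w3 : W × W → Finset (Sym2 W) → ℝ := fun z S =>
    if s(x, z.1) ∈ S ∧ s(x, z.2) ∈ S then 1 else 0
  -- the degree, and three stages that reveal the edges from `x` to `I`, from `x` to `J`, and
  -- between `I` and `J`
  have h0 := bernoulliProb_degree_le Γ hE hp.le hp1 (n := n) (x := x) (I := A)
    ((Finset.card_filter_le _ _).trans hI) (fun a ha => (hAI a ha).2)
  have h1 := bernoulliProb_sum_ge_le (E := E) hp.le hp1 A (φ := fun a => s(x, a))
    (fun a _ b _ h => Sym2.congr_right.1 h) (fun a ha => (hE _).2 (hAI a ha).2)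
    (w := w1) (fun _ _ => Finset.sum_nonneg fun _ _ => by split_ifs <;> norm_num)
    (fun _ _ _ _ _ => rfl) (v := n) (m := p * n ^ 2) hn' hθ.le hθ1
  have h2 := bernoulliProb_sum_ge_le (E := E) hp.le hp1 B (φ := fun a => s(x, a))
    (fun a _ b _ h => Sym2.congr_right.1 h) (fun a ha => (hE _).2 (hBJ a ha).2)
    (w := w2) (fun _ _ => Finset.sum_nonneg fun _ _ => by split_ifs <;> norm_num)
    (fun b _ b' hb' S => by
      refine Finset.sum_congr rfl fun a ha => ?_
      have : s(x, a) ≠ s(x, b') := fun h => hne a ha b' hb' (Sym2.congr_right.1 h)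
      simp [this]) (v := 3 * (p * n)) (m := 3 * p ^ 2 * n ^ 2) (by positivity) hθ.le hθ1
  have h3 := bernoulliProb_sum_ge_le (E := E) hp.le hp1 K (φ := fun z => s(z.1, z.2))
    (fun z hz z' hz' h => by
      obtain ⟨ha, hb, -⟩ := hK z hz
      obtain ⟨ha', hb', -⟩ := hK z' hz'
      rcases Sym2.eq_iff.1 h with h | h
      · exact Prod.ext h.1 h.2
      · exact absurd h.1 (hne _ ha _ hb'))
    (fun z hz => (hE _).2 (hK z hz).2.2)
    (w := w3) (fun _ _ => by simp only [w3]; split_ifs <;> norm_num)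
    (fun z hz z' hz' S => by
      obtain ⟨ha', hb', -⟩ := hK z' hz'
      have : ∀ c, s(x, c) ≠ s(z'.1, z'.2) := by
        intro c h
        rcases Sym2.eq_iff.1 h with h | h
        · exact hxI (h.1 ▸ (hAI _ ha').1)
        · exact hxJ (h.1 ▸ (hBJ _ hb').1)
      simp [w3, this]) (v := 1) (m := 9 * (p ^ 3 * n ^ 2)) one_pos hθ.le hθ1
  have hθ2 : θ ^ 2 ≤ 1 := pow_le_one₀ hθ.le hθ1
  have hpn : 0 ≤ p * n := by positivity
  have hpn3 : 0 ≤ p ^ 3 * n ^ 2 := by positivity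
  have g0 : Real.exp (-(p * n)) ≤ Real.exp (-k) := by
    rw [Real.exp_le_exp]; nlinarith
  have g1 : Real.exp (-(θ ^ 2 * (p * n ^ 2) / n)) ≤ Real.exp (-k) := by
    have : θ ^ 2 * (p * n ^ 2) / n = θ ^ 2 * (p * n) := by field_simp
    rw [Real.exp_le_exp, this]; linarith
  have g2 : Real.exp (-(θ ^ 2 * (3 * p ^ 2 * n ^ 2) / (3 * (p * n)))) ≤ Real.exp (-k) := by
    have : θ ^ 2 * (3 * p ^ 2 * n ^ 2) / (3 * (p * n)) = θ ^ 2 * (p * n) := by field_simp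
    rw [Real.exp_le_exp, this]; linarith
  have g3 : Real.exp (-(θ ^ 2 * (9 * (p ^ 3 * n ^ 2)) / 1)) ≤ Real.exp (-k) := by
    have : 0 ≤ θ ^ 2 * (p ^ 3 * n ^ 2) := by positivity
    rw [Real.exp_le_exp, div_one]; linarith
  have hsum : 4 * Real.exp (-k) = Real.exp (-k) + (Real.exp (-k) + (Real.exp (-k) +
      Real.exp (-k))) := by ring
  rw [hsum]
  refine le_trans ?_ (add_le_add (h0.trans g0) (add_le_add (h1.trans g1)
    (add_le_add (h2.trans g2) (h3.trans g3))))
  refine le_trans ?_ (add_le_add_right (add_le_add_right (bernoulliProb_or_le hp.le hp1 _ _) _) _)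
  refine le_trans ?_ (add_le_add_right (bernoulliProb_or_le hp.le hp1 _ _) _)
  refine le_trans ?_ (bernoulliProb_or_le hp.le hp1 _ _)
  refine bernoulliProb_mono hp.le hp1 fun S hS hlt => ?_
  by_contra hcon
  simp only [not_or] at hcon
  obtain ⟨c0, c1, c2, c3⟩ := hcon
  rw [not_le] at c0
  set t0 : ℝ := (((I ×ˢ J).filter fun z => Γ.Adj x z.1 ∧ Γ.Adj x z.2 ∧ Γ.Adj z.1 z.2).card : ℝ)
    with ht0
  have s1 : ∑ a ∈ A, w1 a S = t0 := by
    have : (I ×ˢ J).filter (fun z => Γ.Adj x z.1 ∧ Γ.Adj x z.2 ∧ Γ.Adj z.1 z.2) = K := by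
      ext z
      simp only [K, A, B, Finset.mem_filter, Finset.mem_product]
      tauto
    rw [ht0, this, Finset.card_filter, Nat.cast_sum, Finset.sum_product]
    simp [w1]
  have s2 : ∑ b ∈ B, w2 b S = ∑ a ∈ A, if s(x, a) ∈ S then w1 a S else 0 := by
    simp only [w2, w1]
    rw [Finset.sum_comm]
    refine Finset.sum_congr rfl fun a _ => ?_
    split_ifs with h <;> simp [h]
  have s3 : ∑ z ∈ K, w3 z S = ∑ b ∈ B, if s(x, b) ∈ S then w2 b S else 0 := by
    simp only [K, w3, w2]
    rw [Finset.sum_filter, Finset.sum_product, Finset.sum_comm]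
    refine Finset.sum_congr rfl fun b _ => ?_
    split_ifs with h
    · refine Finset.sum_congr rfl fun a _ => ?_
      by_cases h1 : s(x, a) ∈ S <;> by_cases h2 : Γ.Adj a b <;> simp [h, h1, h2]
    · simp [h]
  have s4 : (∑ z ∈ K, if s(z.1, z.2) ∈ S then w3 z S else 0) =
      (((I ×ˢ J).filter fun z => s(x, z.1) ∈ S ∧ s(x, z.2) ∈ S ∧ s(z.1, z.2) ∈ S).card : ℝ) := by
    simp only [w3, ← ite_and]
    rw [Finset.sum_boole]
    congr 2
    ext z
    have q : ∀ a b, s(a, b) ∈ S → Γ.Adj a b := fun a b h => (hE _).1 (hS h)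
    simp only [K, A, B, Finset.mem_filter, Finset.mem_product]
    constructor
    · tauto
    · rintro ⟨⟨e1, e2⟩, e3, e4, e5⟩
      exact ⟨⟨⟨⟨e1, q _ _ e3⟩, e2, q _ _ e4⟩, q _ _ e5⟩, e5, e3, e4⟩
  have b1 : ∀ a ∈ A, w1 a S ≤ n := by
    intro a _
    simp only [w1]
    rw [Finset.sum_boole]
    exact le_trans (by exact_mod_cast Finset.card_filter_le _ _) hBn
  have b2 : ∀ b ∈ B, w2 b S ≤ 3 * (p * n) := by
    intro b _
    simp only [w2]
    rw [Finset.sum_boole]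
    refine le_trans ?_ c0.le
    exact_mod_cast Finset.card_le_card fun a ha => by
      simp only [Finset.mem_filter] at ha ⊢
      exact ⟨ha.1, ha.2.1⟩
  have b3 : ∀ z ∈ K, w3 z S ≤ 1 := by
    intro z _
    simp only [w3]
    split_ifs <;> norm_num
  have m1 : ∑ a ∈ A, w1 a S ≤ n ^ 2 := by
    calc _ ≤ ∑ a ∈ A, (n : ℝ) := Finset.sum_le_sum b1
      _ = A.card * n := by simp
      _ ≤ n * n := by gcongr
      _ = _ := by ring
  have m1' : p * ∑ a ∈ A, w1 a S ≤ p * n ^ 2 := mul_le_mul_of_nonneg_left m1 hp.le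
  have z1 := not_le.1 fun h => c1 ⟨b1, m1', h⟩
  have m2 : p * ∑ b ∈ B, w2 b S ≤ 3 * p ^ 2 * n ^ 2 := by
    calc _ ≤ p * ∑ b ∈ B, (3 * (p * n)) :=
          mul_le_mul_of_nonneg_left (Finset.sum_le_sum b2) hp.le
      _ = p * (B.card * (3 * (p * n))) := by simp
      _ ≤ p * (n * (3 * (p * n))) := by gcongr
      _ = _ := by ring
  have z2 := not_le.1 fun h => c2 ⟨b2, m2, h⟩
  rw [← s2] at z1
  rw [← s3] at z2
  have hp2 : 0 ≤ p ^ 2 := by positivity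
  have z1' := mul_le_mul_of_nonneg_left z1.le hp2
  have z2' := mul_le_mul_of_nonneg_left z2.le hp.le
  have m3 : p * ∑ z ∈ K, w3 z S ≤ 9 * (p ^ 3 * n ^ 2) := by
    have m1'' := mul_le_mul_of_nonneg_left m1' hp2
    have := mul_le_mul_of_nonneg_right hθ1 hpn3
    linarith
  have z3 := not_le.1 fun h => c3 ⟨b3, m3, h⟩
  rw [s4, ← not_le] at z3
  apply z3
  rw [s1] at z1'
  linarith

end RandomSubgraph

/-! ### Triangles in super-regular tripartite graphs -/

section Regular

variable {W : Type*} {Γ : SimpleGraph W} {ε d : ℝ} {n : ℕ}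

theorem IsRegularPair.card_edges_le [DecidableRel Γ.Adj] {A B : Finset W}
    (h : IsRegularPair Γ ε d A B)
    {S T : Finset W} (hS : S ⊆ A) (hT : T ⊆ B) (hSc : A.card * ε ≤ S.card)
    (hTc : B.card * ε ≤ T.card) :
    (((S ×ˢ T).filter fun z => Γ.Adj z.1 z.2).card : ℝ) ≤ (d + ε) * (S.card * T.card) := by
  classical
  obtain ⟨hu, hd⟩ := h
  have h1 := hu hS hT hSc hTc
  rw [hd] at h1
  have h2 := (abs_lt.1 h1).2
  rcases Nat.eq_zero_or_pos (S.card * T.card) with h0 | h0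
  · have : (S ×ˢ T).card = 0 := by rw [Finset.card_product, h0]
    have h3 : ((S ×ˢ T).filter fun z => Γ.Adj z.1 z.2).card = 0 :=
      Nat.le_zero.1 (this ▸ Finset.card_filter_le _ _)
    have h4 : (S.card : ℝ) * T.card = 0 := by exact_mod_cast h0
    rw [h3, h4]
    simp
  · have h0' : (0 : ℝ) < (S.card : ℝ) * T.card := by exact_mod_cast h0
    rw [SimpleGraph.edgeDensity_def] at h2
    push_cast at h2
    have e : ((S ×ˢ T).filter fun z => Γ.Adj z.1 z.2) = @SimpleGraph.interedges W Γ
        (fun _ _ => Classical.propDecidable _) S T := by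
      ext z
      rw [SimpleGraph.mem_interedges_iff]
      simp [and_assoc]
    have h3 : (((S ×ˢ T).filter fun z => Γ.Adj z.1 z.2).card : ℝ) / (S.card * T.card) < d + ε := by
      have : (((S ×ˢ T).filter fun z => Γ.Adj z.1 z.2).card : ℝ) / (S.card * T.card) - d < ε := by
        rw [e]
        exact h2
      linarith
    exact ((div_lt_iff₀ h0').1 h3).le

/-- Super-regularity bounds degrees from below only, but regularity makes vertices of large degree
rare. -/
theorem IsRegularPair.card_degree_gt_le [DecidableRel Γ.Adj] {A B : Finset W}
    (h : IsRegularPair Γ ε d A B) (hA : A.card = n) (hB : B.card = n) (hε : 0 < ε) (hε1 : ε ≤ 1) :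
    (((A.filter fun x => (d + ε) * n < ((B.filter fun b => Γ.Adj x b).card : ℝ)).card : ℕ) : ℝ) ≤
      ε * n := by
  by_contra! hlt
  set S := A.filter fun x => (d + ε) * n < ((B.filter fun b => Γ.Adj x b).card : ℝ) with hS
  have h1 := h.card_edges_le (S := S) (Finset.filter_subset _ _) (Finset.Subset.refl B)
    (by rw [hA]; linarith) (by rw [hB]; nlinarith [(Nat.cast_nonneg n : (0 : ℝ) ≤ n)])
  have hSpos : 0 < S.card := by
    have : (0 : ℝ) < S.card := lt_of_le_of_lt (by positivity) hlt
    exact_mod_cast this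
  have h2 : ∑ x ∈ S, (d + ε) * n < ∑ x ∈ S, ((B.filter fun b => Γ.Adj x b).card : ℝ) :=
    Finset.sum_lt_sum_of_nonempty (Finset.card_pos.1 hSpos)
      fun x hx => (Finset.mem_filter.1 hx).2
  have h3 : ∑ x ∈ S, ((B.filter fun b => Γ.Adj x b).card : ℝ) =
      (((S ×ˢ B).filter fun z => Γ.Adj z.1 z.2).card : ℝ) := by
    simp only [Finset.card_filter, Finset.sum_product, Nat.cast_sum]
  rw [h3, Finset.sum_const, nsmul_eq_mul] at h2
  rw [hB] at h1
  linarith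

/-- All but at most `2 ε n` vertices of a class lie in about at most `d³ n²` triangles. -/
theorem exists_card_triangles_le [DecidableEq W] [DecidableRel Γ.Adj] {A B C : Finset W}
    (hAB : IsRegularPair Γ ε d A B) (hAC : IsRegularPair Γ ε d A C) (hBC : IsRegularPair Γ ε d B C)
    (hA : A.card = n) (hB : B.card = n) (hC : C.card = n)
    (hε : 0 < ε) (hε1 : ε ≤ 1) (hd : 0 ≤ d) (hd1 : d ≤ 1) :
    ∃ X : Finset W, (X.card : ℝ) ≤ 2 * ε * n ∧ ∀ x ∈ A, x ∉ X →
      (((B ×ˢ C).filter fun z => Γ.Adj x z.1 ∧ Γ.Adj x z.2 ∧ Γ.Adj z.1 z.2).card : ℝ) ≤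
        (d ^ 3 + 8 * ε) * n ^ 2 := by
  refine ⟨(A.filter fun x => (d + ε) * n < ((B.filter fun b => Γ.Adj x b).card : ℝ)) ∪
    (A.filter fun x => (d + ε) * n < ((C.filter fun b => Γ.Adj x b).card : ℝ)), ?_, ?_⟩
  · have h1 := hAB.card_degree_gt_le hA hB hε hε1
    have h2 := hAC.card_degree_gt_le hA hC hε hε1
    refine le_trans (Nat.cast_le.2 (Finset.card_union_le _ _)) ?_
    rw [Nat.cast_add]
    linarith
  · intro x hx hX
    simp only [Finset.mem_union, Finset.mem_filter, hx, true_and, not_or, not_lt] at hX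
    obtain ⟨hxB, hxC⟩ := hX
    set N := B.filter fun b => Γ.Adj x b with hN
    set N' := C.filter fun b => Γ.Adj x b with hN'
    have e1 : (B ×ˢ C).filter (fun z => Γ.Adj x z.1 ∧ Γ.Adj x z.2 ∧ Γ.Adj z.1 z.2) =
        (N ×ˢ N').filter fun z => Γ.Adj z.1 z.2 := by
      ext z
      simp only [hN, hN', Finset.mem_filter, Finset.mem_product]
      tauto
    rw [e1]
    have hn0 : (0 : ℝ) ≤ n := Nat.cast_nonneg n
    have hNn : (N.card : ℝ) ≤ n := by rw [← hB]; exact_mod_cast Finset.card_filter_le _ _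
    have hNn' : (N'.card : ℝ) ≤ n := by rw [← hC]; exact_mod_cast Finset.card_filter_le _ _
    have hprod : (((N ×ˢ N').filter fun z => Γ.Adj z.1 z.2).card : ℝ) ≤ N.card * N'.card := by
      exact_mod_cast (Finset.card_filter_le _ _).trans_eq (Finset.card_product _ _)
    have hd3 : 0 ≤ d ^ 3 := by positivity
    have hfin : ∀ q : ℝ, q ≤ (d + ε) ^ 3 * n ^ 2 ∨ q ≤ ε * n ^ 2 →
        q ≤ (d ^ 3 + 8 * ε) * n ^ 2 := by
      rintro q (h | h)
      · refine h.trans (mul_le_mul_of_nonneg_right ?_ (by positivity))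
        have : d ^ 2 ≤ 1 := pow_le_one₀ hd hd1
        have : ε ^ 2 ≤ ε := by nlinarith
        have : ε ^ 3 ≤ ε := by nlinarith
        have : d * ε ^ 2 ≤ ε := by nlinarith
        nlinarith
      · exact h.trans (mul_le_mul_of_nonneg_right (by linarith) (by positivity))
    apply hfin
    by_cases h1 : n * ε ≤ N.card
    · by_cases h2 : n * ε ≤ N'.card
      · left
        have := hBC.card_edges_le (S := N) (T := N') (Finset.filter_subset _ _)
          (Finset.filter_subset _ _) (by rw [hB]; exact h1) (by rw [hC]; exact h2)
        refine this.trans ?_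
        calc (d + ε) * ((N.card : ℝ) * N'.card)
            ≤ (d + ε) * (((d + ε) * n) * ((d + ε) * n)) := by gcongr
          _ = _ := by ring
      · right
        refine hprod.trans ?_
        calc (N.card : ℝ) * N'.card ≤ n * (n * ε) := by
              gcongr; exact (not_le.1 h2).le
          _ = _ := by ring
    · right
      refine hprod.trans ?_
      calc (N.card : ℝ) * N'.card ≤ (n * ε) * n := by
            gcongr; exact (not_le.1 h1).le
        _ = _ := by ring

end Regular

/-! ### Typical subgraphs of tripartite graphs -/

section Typical

variable {V : Fin 3 → Type*} [∀ i, Fintype (V i)]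

/-- The number of triangles through the vertex `x` of class `i` with one vertex in each of the
classes `j` and `k`. -/
def triangleCount (G : SimpleGraph (Σ i, V i)) {i : Fin 3} (x : V i) (j k : Fin 3) : ℕ :=
  open Classical in (Finset.univ.filter fun z : V j × V k =>
    G.Adj ⟨i, x⟩ ⟨j, z.1⟩ ∧ G.Adj ⟨i, x⟩ ⟨k, z.2⟩ ∧ G.Adj ⟨j, z.1⟩ ⟨k, z.2⟩).card

/-- The number of common neighbours of `x` and `y` in the class `k`. -/
def codegree (G : SimpleGraph (Σ i, V i)) (x y : Σ i, V i) (k : Fin 3) : ℕ :=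
  open Classical in (Finset.univ.filter fun z : V k => G.Adj x ⟨k, z⟩ ∧ G.Adj y ⟨k, z⟩).card

theorem card_partSet (i : Fin 3) : (partSet V i).card = Fintype.card (V i) := by
  simp [partSet]

theorem mem_partSet {i : Fin 3} {x : Σ i, V i} : x ∈ partSet V i ↔ x.1 = i := by
  obtain ⟨j, x⟩ := x
  simp only [partSet, Finset.mem_map, Finset.mem_univ, true_and, Function.Embedding.sigmaMk_apply]
  constructor
  · rintro ⟨y, hy⟩
    exact (congrArg Sigma.fst hy).symm
  · rintro rfl
    exact ⟨x, rfl⟩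

theorem card_filter_partSet (k : Fin 3) (R : (Σ i, V i) → Prop) [DecidablePred R] :
    ((partSet V k).filter R).card =
      (Finset.univ.filter fun z : V k => R ⟨k, z⟩).card := by
  rw [partSet, Finset.filter_map, Finset.card_map]
  rfl

theorem card_filter_partSet_product (j k : Fin 3) (R : (Σ i, V i) × (Σ i, V i) → Prop)
    [DecidablePred R] :
    ((partSet V j ×ˢ partSet V k).filter R).card =
      (Finset.univ.filter fun z : V j × V k => R (⟨j, z.1⟩, ⟨k, z.2⟩)).card := by
  symm
  refine Finset.card_bij (fun z _ => (⟨j, z.1⟩, ⟨k, z.2⟩)) ?_ ?_ ?_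
  · intro z hz
    simp only [Finset.mem_filter, Finset.mem_univ, true_and] at hz
    simp [hz, mem_partSet]
  · intro z _ z' _ h
    simpa [Prod.ext_iff] using h
  · rintro ⟨⟨j', y⟩, ⟨k', z⟩⟩ h
    simp only [Finset.mem_filter, Finset.mem_product, mem_partSet] at h
    obtain ⟨⟨rfl, rfl⟩, h⟩ := h
    exact ⟨(y, z), by simpa using h, rfl⟩

/-- The properties of the random subgraph `G` of `Γ` used in the counting argument: no vertex is in
many more triangles than expected, and no pair of vertices has a large codegree. -/
structure IsTypical (Γ G : SimpleGraph (Σ i, V i)) (p b c : ℝ) : Prop where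
  triangleCount_le : ∀ (i j k : Fin 3), i ≠ j → i ≠ k → j ≠ k → ∀ x : V i,
    (triangleCount G x j k : ℝ) ≤ p ^ 3 * triangleCount Γ x j k + b
  codegree_le : ∀ (x y : Σ i, V i) (k : Fin 3), x ≠ y → x.1 ≠ k → (codegree G x y k : ℝ) ≤ c

theorem bernoulliProb_and_le {α : Type*} [DecidableEq α] {E : Finset α} {p : ℝ}
    {P : Prop} {Q : Finset α → Prop} {r : ℝ} (hr : 0 ≤ r)
    (h : P → bernoulliProb E p Q ≤ r) : bernoulliProb E p (fun S => P ∧ Q S) ≤ r := by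
  by_cases hP : P
  · simpa [hP] using h hP
  · simpa [hP, bernoulliProb, bernoulliExpect] using hr

/-- `Γ_p` is typical with high probability: a union bound over vertices and pairs. -/
theorem one_sub_le_sparsification_isTypical {n : ℕ} (hV : ∀ i, Fintype.card (V i) = n)
    (hn : 0 < n) (Γ : SimpleGraph (Σ i, V i)) (p : unitInterval) (hp : 0 < (p : ℝ)) {θ k m : ℝ}
    (hθ : 0 < θ) (hθ1 : θ ≤ 1)
    (hk0 : k ≤ p * n) (hk1 : k ≤ θ ^ 2 * (p * n)) (hk2 : k ≤ θ ^ 2 * ((p : ℝ) ^ 3 * n ^ 2))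
    (hkm : k ≤ m) (hm : 3 * (p : ℝ) ^ 2 * n ≤ m) :
    1 - 162 * (n : ℝ) ^ 2 * Real.exp (-k) ≤ (sparsification Γ p).real
      {G | IsTypical Γ G p (26 * θ * ((p : ℝ) ^ 3 * n ^ 2)) (3 * m)} := by
  classical
  let W := Σ i, V i
  have hp1 : (p : ℝ) ≤ 1 := p.2.2
  have hW : Fintype.card W = 3 * n := by simp [W, hV]
  let Q1 : W × Fin 3 × Fin 3 → Finset (Sym2 W) → Prop := fun q S =>
    (q.1.1 ≠ q.2.1 ∧ q.1.1 ≠ q.2.2 ∧ q.2.1 ≠ q.2.2) ∧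
    (p : ℝ) ^ 3 * (((partSet V q.2.1 ×ˢ partSet V q.2.2).filter fun z =>
        Γ.Adj q.1 z.1 ∧ Γ.Adj q.1 z.2 ∧ Γ.Adj z.1 z.2).card : ℝ) +
        26 * θ * ((p : ℝ) ^ 3 * n ^ 2) <
      (((partSet V q.2.1 ×ˢ partSet V q.2.2).filter fun z =>
        s(q.1, z.1) ∈ S ∧ s(q.1, z.2) ∈ S ∧ s(z.1, z.2) ∈ S).card : ℝ)
  let Q2 : W × W × Fin 3 → Finset (Sym2 W) → Prop := fun q S =>
    (q.1 ≠ q.2.1 ∧ q.1.1 ≠ q.2.2) ∧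
    3 * m < (((partSet V q.2.2).filter fun a => s(q.1, a) ∈ S ∧ s(q.2.1, a) ∈ S).card : ℝ)
  have hE : ∀ e, e ∈ Γ.edgeFinset ↔ e ∈ Γ.edgeSet := fun e => SimpleGraph.mem_edgeFinset
  have hcard : ∀ i, (partSet V i).card ≤ n := fun i => by rw [card_partSet, hV]
  have hQ1 : ∀ q, bernoulliProb Γ.edgeFinset p (Q1 q) ≤ 4 * Real.exp (-k) := by
    intro q
    refine bernoulliProb_and_le (by positivity) ?_
    rintro ⟨h1, h2, h3⟩
    refine le_trans (le_of_eq ?_) (bernoulliProb_triangles_le Γ hE hp hp1 hn (hcard q.2.1)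
      (hcard q.2.2) (x := q.1) (by rwa [mem_partSet]) (by rwa [mem_partSet])
      (Finset.disjoint_left.2 fun a ha hb =>
        h3 ((mem_partSet.1 ha).symm.trans (mem_partSet.1 hb))) hθ hθ1 hk1 hk2)
    congr!
  have hQ2 : ∀ q, bernoulliProb Γ.edgeFinset p (Q2 q) ≤ 2 * Real.exp (-k) := by
    intro q
    refine bernoulliProb_and_le (by positivity) ?_
    rintro ⟨h1, h2⟩
    refine (bernoulliProb_codegree_le Γ hE hp.le hp1 (hcard q.2.2) h1 (by rwa [mem_partSet])
      hm).trans ?_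
    rw [two_mul]
    exact add_le_add (Real.exp_le_exp.2 (by linarith)) (Real.exp_le_exp.2 (by linarith))
  have hbad : bernoulliProb Γ.edgeFinset p (fun S => (∃ q ∈ Finset.univ, Q1 q S) ∨
      ∃ q ∈ Finset.univ, Q2 q S) ≤ 162 * (n : ℝ) ^ 2 * Real.exp (-k) := by
    refine (bernoulliProb_or_le hp.le hp1 _ _).trans ?_
    have h1 := (bernoulliProb_exists_le hp.le hp1 Finset.univ Q1).trans
      (Finset.sum_le_sum fun q _ => hQ1 q)
    have h2 := (bernoulliProb_exists_le hp.le hp1 Finset.univ Q2).trans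
      (Finset.sum_le_sum fun q _ => hQ2 q)
    rw [Finset.sum_const, Finset.card_univ, nsmul_eq_mul] at h1 h2
    simp only [Fintype.card_prod, hW, Fintype.card_fin] at h1 h2
    push_cast at h1 h2
    have hn1 : (1 : ℝ) ≤ n := by exact_mod_cast hn
    have he := (Real.exp_pos (-k)).le
    have h3 : (n : ℝ) * Real.exp (-k) ≤ (n : ℝ) ^ 2 * Real.exp (-k) := by
      gcongr; nlinarith
    linarith
  refine le_trans (by linarith) (one_sub_bernoulliProb_le_sparsification Γ p
    (fun S => (∃ q ∈ Finset.univ, Q1 q S) ∨ ∃ q ∈ Finset.univ, Q2 q S) _ ?_)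
  intro S hS hQ G hG
  obtain ⟨hno1, hno2⟩ := not_or.1 hQ
  have hadj : ∀ a b, s(a, b) ∈ S ↔ G.Adj a b := fun a b => by
    rw [← SimpleGraph.mem_edgeSet, hG, Finset.mem_coe]
  refine ⟨fun i j k' hij hik hjk x => ?_, fun x y k' hxy hxk => ?_⟩
  · have h := not_lt.1 fun h => hno1 ⟨(⟨i, x⟩, j, k'), Finset.mem_univ _, ⟨hij, hik, hjk⟩, h⟩
    simp only [hadj, card_filter_partSet_product] at h
    simp only [triangleCount]
    convert h
  · have h := not_lt.1 fun h => hno2 ⟨(x, y, k'), Finset.mem_univ _, ⟨hxy, hxk⟩, h⟩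
    simp only [hadj] at h
    refine le_trans (le_of_eq ?_) h
    rw [codegree, Nat.cast_inj]
    convert (card_filter_partSet k' fun a => G.Adj x a ∧ G.Adj y a).symm

end Typical

/-! ### Entropy of functions of a uniform random variable -/

section UniformEntropy

variable {Ω S : Type*}

theorem filter_uniformOfFinset (F : Finset Ω) (hF : F.Nonempty) (E : Set Ω)
    (hE : ∃ ω ∈ E, ω ∈ (PMF.uniformOfFinset F hF).support) [DecidablePred (· ∈ E)]
    (hF' : (F.filter (· ∈ E)).Nonempty) :
    (PMF.uniformOfFinset F hF).filter E hE = PMF.uniformOfFinset (F.filter (· ∈ E)) hF' := by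
  classical
  ext ω
  have h1 : ∑' a, E.indicator (PMF.uniformOfFinset F hF) a =
      ((F.filter (· ∈ E)).card : ENNReal) / F.card := by
    rw [← PMF.toOuterMeasure_apply, PMF.toOuterMeasure_uniformOfFinset_apply]
    congr!
  rw [PMF.filter_apply, h1, PMF.uniformOfFinset_apply, Set.indicator_apply,
    PMF.uniformOfFinset_apply]
  have h2 : (F.card : ENNReal) ≠ 0 := by simpa using hF.ne_empty
  have h3 : ((F.filter (· ∈ E)).card : ENNReal) ≠ 0 := by
    simpa only [ne_eq, Nat.cast_eq_zero, Finset.card_eq_zero] using hF'.ne_empty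
  by_cases hω : ω ∈ E <;> by_cases hωF : ω ∈ F
  · simp only [hω, hωF, if_true, Finset.mem_filter, and_self]
    rw [ENNReal.inv_div (.inr (ENNReal.natCast_ne_top _)) (.inr h3), div_eq_mul_inv, ← mul_assoc,
      ENNReal.inv_mul_cancel h2 (ENNReal.natCast_ne_top _), one_mul]
  all_goals simp [hω, hωF]

/-- The entropy of `X` under the uniform distribution on `F` is the mean of the information content
of the value of `X`. -/
theorem card_mul_entropy_map [Fintype S] [DecidableEq S] (F : Finset Ω) (hF : F.Nonempty)
    (X : Ω → S) :
    (F.card : ℝ) * entropy ((PMF.uniformOfFinset F hF).map X) =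
      ∑ ω ∈ F, -Real.log (((F.filter fun ω' => X ω' = X ω).card : ℝ) / F.card) := by
  classical
  have hc : (F.card : ℝ) ≠ 0 := by simpa using hF.ne_empty
  have h1 : ∀ s, (((PMF.uniformOfFinset F hF).map X) s).toReal =
      ((F.filter fun ω' => X ω' = s).card : ℝ) / F.card := by
    intro s
    have : ((PMF.uniformOfFinset F hF).map X) s =
        ((PMF.uniformOfFinset F hF).map X).toOuterMeasure {s} := by
      rw [PMF.toOuterMeasure_apply_singleton]
    rw [this, PMF.toOuterMeasure_map_apply, PMF.toOuterMeasure_uniformOfFinset_apply,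
      ENNReal.toReal_div]
    simp only [Set.mem_preimage, Set.mem_singleton_iff, ENNReal.toReal_natCast]
  rw [entropy, Finset.mul_sum, ← Finset.sum_fiberwise F X]
  refine Finset.sum_congr rfl fun s _ => ?_
  have h2 : ∀ ω ∈ F.filter fun ω => X ω = s,
      -Real.log (((F.filter fun ω' => X ω' = X ω).card : ℝ) / F.card) =
      -Real.log (((F.filter fun ω' => X ω' = s).card : ℝ) / F.card) := by
    intro ω hω
    rw [(Finset.mem_filter.1 hω).2]
  rw [Finset.sum_congr rfl h2, h1, Finset.sum_const, nsmul_eq_mul, Real.negMulLog]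
  field_simp

end UniformEntropy

/-! ### Embeddings as families of triangles -/

section Encoding

variable {V : Fin 3 → Type*} {t : ℕ}

/-- The triangles of `G`, rooted at their vertex of class `ℓ`. -/
def rootedTriangle (G : SimpleGraph (Σ i, V i)) (ℓ : Fin 3) (a : V ℓ) (b : V (ℓ + 1))
    (c : V (ℓ + 2)) : Prop :=
  G.Adj ⟨ℓ, a⟩ ⟨ℓ + 1, b⟩ ∧ G.Adj ⟨ℓ, a⟩ ⟨ℓ + 2, c⟩ ∧ G.Adj ⟨ℓ + 1, b⟩ ⟨ℓ + 2, c⟩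

/-- The map on `[t] × [3]` given by its restrictions to the class `ℓ` and to the other two. -/
def encode {ℓ : Fin 3} (z : (Fin t → V ℓ) × (Fin t → V (ℓ + 1) × V (ℓ + 2))) :
    Fin t × Fin 3 → Σ i, V i := fun q =>
  if q.2 = ℓ then ⟨ℓ, z.1 q.1⟩
  else if q.2 = ℓ + 1 then ⟨ℓ + 1, (z.2 q.1).1⟩ else ⟨ℓ + 2, (z.2 q.1).2⟩

theorem fin_three_ne (ℓ : Fin 3) : ℓ + 1 ≠ ℓ ∧ ℓ + 2 ≠ ℓ ∧ ℓ + 2 ≠ ℓ + 1 := by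
  decide +revert

theorem fin_three_cases (ℓ i : Fin 3) : i = ℓ ∨ i = ℓ + 1 ∨ i = ℓ + 2 := by
  decide +revert

variable {ℓ : Fin 3} (z : (Fin t → V ℓ) × (Fin t → V (ℓ + 1) × V (ℓ + 2)))

@[simp] theorem encode_root (s : Fin t) : encode z (s, ℓ) = ⟨ℓ, z.1 s⟩ := by
  simp [encode]

@[simp] theorem encode_fst (s : Fin t) : encode z (s, ℓ + 1) = ⟨ℓ + 1, (z.2 s).1⟩ := by
  simp [encode, (fin_three_ne ℓ).1]

@[simp] theorem encode_snd (s : Fin t) : encode z (s, ℓ + 2) = ⟨ℓ + 2, (z.2 s).2⟩ := by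
  simp [encode, (fin_three_ne ℓ).2]

theorem encode_injective : Function.Injective (encode (V := V) (t := t) (ℓ := ℓ)) := by
  intro z z' h
  have h0 : ∀ q, encode z q = encode z' q := fun q => congrFun h q
  refine Prod.ext (funext fun s => ?_) (funext fun s => Prod.ext ?_ ?_)
  · simpa using h0 (s, ℓ)
  · simpa using h0 (s, ℓ + 1)
  · simpa using h0 (s, ℓ + 2)

variable [∀ i, Fintype (V i)]

theorem exists_encode_eq {G : SimpleGraph (Σ i, V i)} {ψ : Fin t × Fin 3 → Σ i, V i}
    (hψ : ψ ∈ embeddings G t) (ℓ : Fin 3) :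
    ∃ z : (Fin t → V ℓ) × (Fin t → V (ℓ + 1) × V (ℓ + 2)), encode z = ψ := by
  classical
  have h : ∀ s i, ∃ y : V i, ψ (s, i) = ⟨i, y⟩ := by
    intro s i
    have h1 := (Finset.mem_filter.1 hψ).2.2.2 s i
    revert h1
    generalize ψ (s, i) = w
    obtain ⟨j, y⟩ := w
    rintro rfl
    exact ⟨y, rfl⟩
  choose g hg using h
  refine ⟨(fun s => g s ℓ, fun s => (g s (ℓ + 1), g s (ℓ + 2))), funext fun q => ?_⟩
  obtain ⟨s, i⟩ := q
  rcases fin_three_cases ℓ i with rfl | rfl | rfl <;> simp [hg]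

theorem isTriangleFamily_of_encode_mem {G : SimpleGraph (Σ i, V i)} {k : ℕ} {us : VertexTuple V k}
    {u : V ℓ} (hz : encode z ∈ embeddingsAvoiding G t us u) :
    IsTriangleFamily (rootedTriangle G ℓ) u z.1 z.2 := by
  classical
  obtain ⟨h1, -, h2⟩ := Finset.mem_filter.1 hz
  obtain ⟨hinj, hadj, -⟩ := (Finset.mem_filter.1 h1).2
  obtain ⟨e1, e2, e3⟩ := fin_three_ne ℓ
  refine ⟨fun s s' h => ?_, fun s h => ?_, fun s s' h => ?_, fun s s' h => ?_, fun s => ?_⟩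
  · have := @hinj (s, ℓ) (s', ℓ) (by simp [h])
    simpa using this
  · exact h2 s (by simp [h])
  · have := @hinj (s, ℓ + 1) (s', ℓ + 1) (by simpa using h)
    simpa using this
  · have := @hinj (s, ℓ + 2) (s', ℓ + 2) (by simpa using h)
    simpa using this
  · have a1 := hadj (s, ℓ) (s, ℓ + 1) ⟨rfl, e1.symm⟩
    have a2 := hadj (s, ℓ) (s, ℓ + 2) ⟨rfl, e2.symm⟩
    have a3 := hadj (s, ℓ + 1) (s, ℓ + 2) ⟨rfl, e3.symm⟩
    simp only [encode_root, encode_fst, encode_snd] at a1 a2 a3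
    exact ⟨a1, a2, a3⟩

/-- The value of `triangleAt` at a root whose triangle has the further vertices `y`. -/
def pairSets (y : V (ℓ + 1) × V (ℓ + 2)) : ∀ j : {j : Fin 3 // j ≠ ℓ}, Finset (V j) := fun j =>
  open Classical in Finset.univ.filter fun w : V j =>
    (⟨j, w⟩ : Σ i, V i) = ⟨ℓ + 1, y.1⟩ ∨ (⟨j, w⟩ : Σ i, V i) = ⟨ℓ + 2, y.2⟩

theorem pairSets_injective : Function.Injective (pairSets (V := V) (ℓ := ℓ)) := by
  classical
  intro y y' h
  obtain ⟨e1, e2, e3⟩ := fin_three_ne ℓ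
  have h1 := congrFun h ⟨ℓ + 1, e1⟩
  have h2 := congrFun h ⟨ℓ + 2, e2⟩
  have g1 : y.1 ∈ pairSets y ⟨ℓ + 1, e1⟩ := by simp [pairSets]
  have g2 : y.2 ∈ pairSets y ⟨ℓ + 2, e2⟩ := by simp [pairSets]
  rw [h1] at g1
  rw [h2] at g2
  simp only [pairSets, Finset.mem_filter, Finset.mem_univ, true_and, Sigma.mk.injEq] at g1 g2
  refine Prod.ext ?_ ?_
  · rcases g1 with g | g
    · exact eq_of_heq g
    · exact absurd g.1.symm e3
  · rcases g2 with g | g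
    · exact absurd g.1 e3
    · exact eq_of_heq g

theorem adj_map_triangles_root {G : SimpleGraph (Σ i, V i)} (hz : encode z ∈ embeddings G t)
    (s : Fin t) (w : Σ i, V i) :
    ((triangles t).map (encode z)).Adj ⟨ℓ, z.1 s⟩ w ↔
      w = ⟨ℓ + 1, (z.2 s).1⟩ ∨ w = ⟨ℓ + 2, (z.2 s).2⟩ := by
  classical
  obtain ⟨hinj, -, -⟩ := (Finset.mem_filter.1 hz).2
  obtain ⟨e1, e2, e3⟩ := fin_three_ne ℓ
  rw [SimpleGraph.map_adj']
  constructor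
  · rintro ⟨-, u', v', ⟨h1, h2⟩, hu, rfl⟩
    rw [← encode_root z s] at hu
    obtain rfl := hinj hu
    obtain ⟨s', i⟩ := v'
    obtain rfl : s = s' := h1
    rcases fin_three_cases ℓ i with rfl | rfl | rfl
    · exact absurd rfl h2
    · left; simp
    · right; simp
  · rintro (rfl | rfl)
    · refine ⟨fun h => e1 (congrArg Sigma.fst h).symm, (s, ℓ), (s, ℓ + 1), ⟨rfl, e1.symm⟩, ?_, ?_⟩
      <;> simp
    · refine ⟨fun h => e2 (congrArg Sigma.fst h).symm, (s, ℓ), (s, ℓ + 2), ⟨rfl, e2.symm⟩, ?_, ?_⟩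
      <;> simp

theorem triangleAt_encode_root {G : SimpleGraph (Σ i, V i)} (hz : encode z ∈ embeddings G t)
    (s : Fin t) : triangleAt (z.1 s) (encode z) = some (pairSets (z.2 s)) := by
  classical
  have hadj := adj_map_triangles_root z hz s
  unfold triangleAt
  rw [if_neg]
  · congr 1
    funext j
    simp only [pairSets, hadj]
  · intro h
    exact h ⟨ℓ + 1, (z.2 s).1⟩ ((hadj _).2 (.inl rfl))

theorem triangleAt_encode_of_forall_ne {v : V ℓ} (hv : ∀ s, z.1 s ≠ v) :
    triangleAt v (encode z) = none := by
  classical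
  unfold triangleAt
  rw [if_pos]
  intro w h
  rw [SimpleGraph.map_adj'] at h
  obtain ⟨-, ⟨s, i⟩, v', -, hu, -⟩ := h
  obtain ⟨e1, e2, e3⟩ := fin_three_ne ℓ
  rcases fin_three_cases ℓ i with rfl | rfl | rfl
  · exact hv s (by simpa using hu)
  · rw [encode_fst] at hu
    exact e1 (congrArg Sigma.fst hu)
  · rw [encode_snd] at hu
    exact e2 (congrArg Sigma.fst hu)

theorem coveredIndicator_eq_one_iff {v : V ℓ} {ψ : Fin t × Fin 3 → Σ i, V i} :
    coveredIndicator v ψ = 1 ↔ triangleAt v ψ ≠ none := by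
  unfold coveredIndicator
  split_ifs with h <;> simp [h]

end Encoding

/-! ### The entropy bound for embeddings -/

section EmbeddingCount

variable {V : Fin 3 → Type*} [∀ i, Fintype (V i)] {t : ℕ} {ℓ : Fin 3}

/-- The probability that the triangle at `a` is completed by the pair `y`, conditional on `a` being
covered, for a uniform element of `Ψ`; it is `0` if `a` is never covered. -/
def triangleProb (Ψ : Finset (Fin t × Fin 3 → Σ i, V i)) (a : V ℓ) (y : V (ℓ + 1) × V (ℓ + 2)) :
    ℝ :=
  open Classical in
  ((Ψ.filter fun ψ => triangleAt a ψ = some (pairSets y)).card : ℝ) /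
    (Ψ.filter fun ψ => triangleAt a ψ ≠ none).card

theorem triangleProb_nonneg (Ψ : Finset (Fin t × Fin 3 → Σ i, V i)) (a : V ℓ)
    (y : V (ℓ + 1) × V (ℓ + 2)) : 0 ≤ triangleProb Ψ a y := by
  unfold triangleProb; positivity

theorem sum_triangleProb_le_one (Ψ : Finset (Fin t × Fin 3 → Σ i, V i)) (a : V ℓ) :
    ∑ y, triangleProb Ψ a y ≤ 1 := by
  classical
  have h : ∑ y : V (ℓ + 1) × V (ℓ + 2),
      (Ψ.filter fun ψ => triangleAt a ψ = some (pairSets y)).card ≤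
      (Ψ.filter fun ψ => triangleAt a ψ ≠ none).card := by
    rw [← Finset.card_biUnion]
    · refine Finset.card_le_card fun ψ hψ => ?_
      simp only [Finset.mem_biUnion, Finset.mem_univ, true_and, Finset.mem_filter] at hψ ⊢
      obtain ⟨y, h1, h2⟩ := hψ
      exact ⟨h1, by simp [h2]⟩
    · intro y _ y' _ hyy
      refine Finset.disjoint_left.2 fun ψ h1 h2 => hyy ?_
      have e1 := (Finset.mem_filter.1 h1).2
      have e2 := (Finset.mem_filter.1 h2).2
      exact pairSets_injective (Option.some.inj (e1.symm.trans e2))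
  unfold triangleProb
  rw [← Finset.sum_div]
  exact div_le_one_of_le₀ (by exact_mod_cast h) (by positivity)

/-- A vertex `a` that fails the entropy bound has small total information content over the elements
of `Ψ` that cover it. This includes the case that no element covers `a`, where both sides vanish. -/
theorem sum_neg_log_triangleProb_le {Ψ : Finset (Fin t × Fin 3 → Σ i, V i)} (hΨ : Ψ.Nonempty)
    {a : V ℓ} {b : ℝ} (ha : ¬ HasCondEntropyAtLeast Ψ hΨ a b) :
    (∑ ψ ∈ Ψ, open Classical in if triangleAt a ψ ≠ none then
      -Real.log (((Ψ.filter fun ψ' => triangleAt a ψ' = triangleAt a ψ).card : ℝ) /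
        (Ψ.filter fun ψ => triangleAt a ψ ≠ none).card) else 0) ≤
      b * (open Classical in (Ψ.filter fun ψ => triangleAt a ψ ≠ none).card : ℝ) := by
  classical
  rw [← Finset.sum_filter]
  set F := Ψ.filter fun ψ => triangleAt a ψ ≠ none with hF
  have hFE : Ψ.filter (· ∈ {ψ | coveredIndicator a ψ = 1}) = F := by
    ext ψ
    simp only [hF, Finset.mem_filter, Set.mem_ofPred_eq, coveredIndicator_eq_one_iff]
  rcases F.eq_empty_or_nonempty with h0 | hne
  · simp [h0]
  · have hE : ∃ ψ ∈ {ψ | coveredIndicator a ψ = 1},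
        ψ ∈ (PMF.uniformOfFinset Ψ hΨ).support := by
      obtain ⟨ψ, hψ⟩ := hne
      rw [← hFE] at hψ
      obtain ⟨h1, h2⟩ := Finset.mem_filter.1 hψ
      exact ⟨ψ, h2, by simpa using h1⟩
    have hlt : condEntropy (PMF.uniformOfFinset Ψ hΨ) (triangleAt a)
        {ψ | coveredIndicator a ψ = 1} hE < b := by
      by_contra hge
      exact ha ⟨hE, not_lt.1 hge⟩
    rw [condEntropy, filter_uniformOfFinset Ψ hΨ _ hE (by rw [hFE]; exact hne)] at hlt
    have h1 := card_mul_entropy_map _ (by rw [hFE]; exact hne :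
      (Ψ.filter (· ∈ {ψ | coveredIndicator a ψ = 1})).Nonempty) (triangleAt a)
    have h2 : ((Ψ.filter (· ∈ {ψ | coveredIndicator a ψ = 1})).card : ℝ) = F.card := by rw [hFE]
    have hc : (0 : ℝ) < F.card := by exact_mod_cast hne.card_pos
    have h3 := (mul_lt_mul_of_pos_left hlt hc).le
    rw [← h2, h1, mul_comm, h2] at h3
    refine le_trans (le_of_eq ?_) h3
    rw [hFE]
    refine Finset.sum_congr rfl fun ψ hψ => ?_
    have e : Ψ.filter (fun ψ' => triangleAt a ψ' = triangleAt a ψ) =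
        F.filter fun ψ' => triangleAt a ψ' = triangleAt a ψ := by
      ext ψ'
      simp only [hF, Finset.mem_filter]
      constructor
      · rintro ⟨h1, h2⟩
        exact ⟨⟨h1, by rw [h2]; exact (Finset.mem_filter.1 hψ).2⟩, h2⟩
      · rintro ⟨⟨h1, _⟩, h2⟩
        exact ⟨h1, h2⟩
    rw [e]

/-- The bound of `log_card_le_of_bad` for embeddings, with the vertices of small conditional entropy
as bad roots. -/
theorem log_card_embeddingsAvoiding_le {G : SimpleGraph (Σ i, V i)} {n k M E : ℕ}
    (hV : ∀ i, Fintype.card (V i) = n) (ht : t < n) (us : VertexTuple V k) (u : V ℓ)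
    (hΨ : (embeddingsAvoiding G t us u).Nonempty) {c D T β δ : ℝ} {e : V ℓ → ℝ} (hT : 0 < T)
    (hβ : 0 ≤ β) (he : ∀ a, 0 ≤ e a) (hM : 0 < M) (hEM : E ≤ M) (hsum : ∑ a, e a ≤ δ)
    (htri : ∀ a, (triangleCount G a (ℓ + 1) (ℓ + 2) : ℝ) ≤ (1 + e a) * T)
    (hD : ∀ (i j k : Fin 3), i ≠ j → i ≠ k → j ≠ k → ∀ x : V i, (triangleCount G x j k : ℝ) ≤ D)
    (hc : ∀ (x y : Σ i, V i) (k : Fin 3), x ≠ y → x.1 ≠ k → (codegree G x y k : ℝ) ≤ c)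
    (hE : ∀ k : Fin M, (k : ℕ) < E → -(β / 2) ≤ Real.log ((((M : ℝ) - k) / M) ^ 2)) :
    Real.log (embeddingsAvoiding G t us u).card ≤ Real.log ((n - 1).descFactorial t) +
      t * (Real.log T + (∑ k : Fin M, Real.log ((((M : ℝ) - k) / M) ^ 2)) / M) + δ +
      (M : ℝ) ^ 2 * (3 * t * c + 2 * ((n : ℝ) - t) * D) / T -
      β / 2 * (E / M) * (({v : V ℓ | ¬ HasCondEntropyAtLeast (embeddingsAvoiding G t us u) hΨ v
        (Real.log T - β)}.ncard : ℝ) - ((n : ℝ) - t)) := by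
  classical
  obtain ⟨e1, e2, e3⟩ := fin_three_ne ℓ
  set Ψ := embeddingsAvoiding G t us u with hΨdef
  let Ψ' : Finset ((Fin t → V ℓ) × (Fin t → V (ℓ + 1) × V (ℓ + 2))) :=
    Finset.univ.filter fun z => encode z ∈ Ψ
  have hmem : ∀ z, z ∈ Ψ' ↔ encode z ∈ Ψ := fun z => by simp [Ψ']
  have himage : Ψ = Ψ'.image encode := by
    ext ψ
    rw [Finset.mem_image]
    constructor
    · intro hψ
      obtain ⟨z, rfl⟩ := exists_encode_eq (Finset.mem_filter.1 hψ).1 ℓ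
      exact ⟨z, (hmem z).2 hψ, rfl⟩
    · rintro ⟨z, hz, rfl⟩
      exact (hmem z).1 hz
  have hcard : Ψ.card = Ψ'.card := by
    conv_lhs => rw [himage]
    exact Finset.card_image_of_injective _ encode_injective
  have hemb : ∀ z ∈ Ψ', encode z ∈ embeddings G t := fun z hz =>
    (Finset.mem_filter.1 ((hmem z).1 hz)).1
  have hfam : ∀ z ∈ Ψ', IsTriangleFamily (rootedTriangle G ℓ) u z.1 z.2 := fun z hz =>
    isTriangleFamily_of_encode_mem z ((hmem z).1 hz)
  let Bad : Finset (V ℓ) := Finset.univ.filter fun v =>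
    ¬ HasCondEntropyAtLeast Ψ hΨ v (Real.log T - β)
  have hBad : {v : V ℓ | ¬ HasCondEntropyAtLeast Ψ hΨ v (Real.log T - β)}.ncard = Bad.card := by
    rw [← Set.ncard_coe_finset]
    simp [Bad]
  have hcov : ∀ z ∈ Ψ', ∀ a, triangleAt a (encode z) ≠ none ↔ ∃ s, z.1 s = a := by
    intro z hz a
    constructor
    · intro h
      by_contra hno
      push Not at hno
      exact h (triangleAt_encode_of_forall_ne z hno)
    · rintro ⟨s, rfl⟩
      rw [triangleAt_encode_root z (hemb z hz)]
      simp
  have hcount : ∀ z ∈ Ψ', ∀ a, (∑ s, if z.1 s = a then (1 : ℝ) else 0) =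
      if triangleAt a (encode z) ≠ none then 1 else 0 := by
    intro z hz a
    split_ifs with h
    · obtain ⟨s, rfl⟩ := (hcov z hz a).1 h
      simp [(hfam z hz).inj.eq_iff]
    · refine Finset.sum_eq_zero fun s _ => if_neg fun hs => h ((hcov z hz a).2 ⟨s, hs⟩)
  rw [hBad, hcard]
  refine log_card_le_of_bad (Tr := rootedTriangle G ℓ) (P := triangleProb Ψ) (e := e) (u := u)
    (triangleProb_nonneg Ψ) (sum_triangleProb_le_one Ψ) Ψ' ?_ hfam ?_ (hV _) (hV _) (hV _) ht hT hβ
    he hM hEM hsum ?_ ?_ ?_ ?_ ?_ ?_ hE ?_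
  · rw [← Finset.card_pos, ← hcard]; exact hΨ.card_pos
  · intro z hz s _
    have h1 := triangleAt_encode_root z (hemb z hz) s
    have h2 := (hmem z).1 hz
    refine div_pos ?_ ?_
    · exact_mod_cast Finset.card_pos.2 ⟨encode z, Finset.mem_filter.2 ⟨h2, h1⟩⟩
    · exact_mod_cast Finset.card_pos.2 ⟨encode z, Finset.mem_filter.2 ⟨h2, by simp [h1]⟩⟩
  · intro a
    refine le_trans (le_of_eq ?_) (htri a)
    rw [triangleCount, trianglePairs, Nat.cast_inj]
    congr 1
    ext y
    simp only [Finset.mem_filter, Finset.mem_univ, true_and]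
    rfl
  · intro b
    refine le_trans (le_of_eq ?_) (hD (ℓ + 1) ℓ (ℓ + 2) e1 e3.symm e2.symm b)
    rw [triangleCount, Nat.cast_inj]
    congr 1
    ext y
    simp only [Finset.mem_filter, Finset.mem_univ, true_and]
    rw [rootedTriangle, G.adj_comm ⟨ℓ, y.1⟩ ⟨ℓ + 1, b⟩]
    tauto
  · intro b
    refine le_trans (le_of_eq ?_) (hD (ℓ + 2) ℓ (ℓ + 1) e2 e3 e1.symm b)
    rw [triangleCount, Nat.cast_inj]
    congr 1
    ext y
    simp only [Finset.mem_filter, Finset.mem_univ, true_and]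
    rw [rootedTriangle, G.adj_comm ⟨ℓ, y.1⟩ ⟨ℓ + 2, b⟩, G.adj_comm ⟨ℓ + 1, y.2⟩ ⟨ℓ + 2, b⟩]
    tauto
  · intro a b
    refine le_trans ?_ (hc ⟨ℓ, a⟩ ⟨ℓ + 1, b⟩ (ℓ + 2) (fun h => e1 (congrArg Sigma.fst h).symm)
      e2.symm)
    rw [codegree, Nat.cast_le]
    refine Finset.card_le_card fun y hy => ?_
    simp only [Finset.mem_filter, Finset.mem_univ, true_and] at hy ⊢
    exact ⟨hy.2.1, hy.2.2⟩
  · intro a b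
    refine le_trans ?_ (hc ⟨ℓ, a⟩ ⟨ℓ + 2, b⟩ (ℓ + 1) (fun h => e2 (congrArg Sigma.fst h).symm)
      e1.symm)
    rw [codegree, Nat.cast_le]
    refine Finset.card_le_card fun y hy => ?_
    simp only [Finset.mem_filter, Finset.mem_univ, true_and] at hy ⊢
    exact ⟨hy.1, hy.2.2.symm⟩
  · intro a b
    refine le_trans ?_ (hc ⟨ℓ + 1, a⟩ ⟨ℓ + 2, b⟩ ℓ (fun h => e3 (congrArg Sigma.fst h).symm) e1)
    rw [codegree, Nat.cast_le]
    refine Finset.card_le_card fun y hy => ?_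
    simp only [Finset.mem_filter, Finset.mem_univ, true_and] at hy ⊢
    exact ⟨hy.1.symm, hy.2.1.symm⟩
  · intro a ha
    have h1 := sum_neg_log_triangleProb_le hΨ (Finset.mem_filter.1 ha).2
    have hre : ∀ g : (Fin t × Fin 3 → Σ i, V i) → ℝ,
        ∑ ψ ∈ Ψ, g ψ = ∑ z ∈ Ψ', g (encode z) := by
      intro g
      conv_lhs => rw [himage]
      exact Finset.sum_image fun z _ z' _ h => encode_injective h
    have h2 : ((Ψ.filter fun ψ => triangleAt a ψ ≠ none).card : ℝ) =
        ∑ z ∈ Ψ', ∑ s, if z.1 s = a then (1 : ℝ) else 0 := by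
      rw [Finset.sum_congr rfl fun z hz => hcount z hz a, Finset.card_filter, Nat.cast_sum, hre]
      refine Finset.sum_congr rfl fun z _ => ?_
      split_ifs <;> simp
    rw [h2, hre] at h1
    refine le_trans (le_of_eq ?_) (h1.trans_eq ?_)
    · refine Finset.sum_congr rfl fun z hz => ?_
      by_cases h : triangleAt a (encode z) ≠ none
      · rw [if_pos h]
        obtain ⟨s, rfl⟩ := (hcov z hz a).1 h
        rw [Finset.sum_eq_single s]
        · rw [if_pos rfl, triangleProb, triangleAt_encode_root z (hemb z hz), ← h2]
        · intro s' _ hs'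
          rw [if_neg fun h => hs' ((hfam z hz).inj h)]
        · simp
      · rw [if_neg h]
        exact Finset.sum_eq_zero fun s _ => if_neg fun hs => h ((hcov z hz a).2 ⟨s, hs⟩)
    · rfl

end EmbeddingCount

/-! ### Estimates for the parameters -/

section Estimates

theorem sum_log_block_eq (M : ℕ) :
    ∑ k : Fin M, Real.log ((((M : ℝ) - k) / M) ^ 2) =
      2 * (Real.log M.factorial - M * Real.log M) := by
  rcases Nat.eq_zero_or_pos M with rfl | hM
  · simp
  have hM' : (M : ℝ) ≠ 0 := by positivity
  have h1 : ∀ k : Fin M, Real.log ((((M : ℝ) - k) / M) ^ 2) =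
      2 * (Real.log ((M : ℝ) - k) - Real.log M) := by
    intro k
    have : (0 : ℝ) < (M : ℝ) - k := by
      have : ((k : ℕ) : ℝ) < M := by exact_mod_cast k.2
      linarith
    rw [Real.log_pow, Real.log_div this.ne' hM']
    norm_num
  rw [Finset.sum_congr rfl fun k _ => h1 k, ← Finset.mul_sum, Finset.sum_sub_distrib]
  congr 2
  · rw [Fin.sum_univ_eq_sum_range fun k => Real.log ((M : ℝ) - k),
      ← Finset.prod_range_add_one_eq_factorial, Nat.cast_prod,
      Real.log_prod (fun i _ => by positivity), ← Finset.sum_range_reflect]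
    refine Finset.sum_congr rfl fun k hk => ?_
    have hk' := Finset.mem_range.1 hk
    rw [Nat.sub_sub, Nat.cast_sub (by omega)]
    congr 1
    push_cast
    ring
  · simp

/-- The average of `log (((M - k) / M) ^ 2)` tends to `∫ log (x ^ 2) = -2` over the unit interval. -/
theorem exists_sum_log_block_le {γ : ℝ} (hγ : 0 < γ) :
    ∃ M : ℕ, 0 < M ∧ (∑ k : Fin M, Real.log ((((M : ℝ) - k) / M) ^ 2)) / M ≤ -2 + γ := by
  have hlim : Filter.Tendsto (fun M : ℕ => 2 * Real.log (Stirling.stirlingSeq 1) / (M : ℝ) +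
      2 * (Real.log (2 * M) ^ 1 / (1 * (2 * (M : ℝ)) + 0))) Filter.atTop (nhds (0 + 2 * 0)) := by
    refine Filter.Tendsto.add ?_ (Filter.Tendsto.const_mul _ ?_)
    · exact tendsto_const_nhds.div_atTop tendsto_natCast_atTop_atTop
    · exact (Real.tendsto_pow_log_div_mul_add_atTop 1 0 1 one_ne_zero).comp
        (tendsto_natCast_atTop_atTop.const_mul_atTop two_pos)
  have hev := (hlim.eventually (gt_mem_nhds (by simpa using hγ : (0 : ℝ) + 2 * 0 < γ))).and
    (Filter.eventually_gt_atTop 0)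
  obtain ⟨M, hM, hM0⟩ := hev.exists
  refine ⟨M, hM0, ?_⟩
  have hMr : (0 : ℝ) < M := by exact_mod_cast hM0
  have h1 := Stirling.log_stirlingSeq_formula M
  have h2 : Real.log (Stirling.stirlingSeq M) ≤ Real.log (Stirling.stirlingSeq 1) := by
    obtain ⟨m, rfl⟩ := Nat.exists_eq_succ_of_ne_zero hM0.ne'
    exact Stirling.log_stirlingSeq'_antitone (Nat.zero_le m)
  rw [Real.log_div hMr.ne' (Real.exp_pos 1).ne', Real.log_exp] at h1
  rw [sum_log_block_eq, div_le_iff₀ hMr]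
  have h3 : (2 * Real.log (Stirling.stirlingSeq 1) / (M : ℝ) +
      2 * (Real.log (2 * M) ^ 1 / (1 * (2 * (M : ℝ)) + 0))) * M =
      2 * Real.log (Stirling.stirlingSeq 1) + Real.log (2 * M) := by
    field_simp
    ring
  have h4 := mul_lt_mul_of_pos_right hM hMr
  rw [h3] at h4
  linarith

theorem log_descFactorial_pred_ge {n t : ℕ} (ht : t < n) :
    t * Real.log n - n ≤ Real.log ((n - 1).descFactorial t) := by
  have hn : (0 : ℝ) < n := by exact_mod_cast (Nat.zero_le t).trans_lt ht
  have hd : (0 : ℝ) < (n - 1).descFactorial t := by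
    exact_mod_cast Nat.descFactorial_pos.2 (by omega)
  have h1 : n.factorial ≤ n ^ (n - t) * (n - 1).descFactorial t := by
    obtain ⟨m, rfl⟩ : ∃ m, n = m + 1 := ⟨n - 1, by omega⟩
    rw [← Nat.factorial_mul_descFactorial (k := t + 1) ht, Nat.succ_descFactorial_succ]
    have h2 : (m + 1 - (t + 1)).factorial ≤ (m + 1) ^ (m + 1 - (t + 1)) :=
      (Nat.factorial_le_pow _).trans (Nat.pow_le_pow_left (by omega) _)
    have h3 : (m + 1) ^ (m + 1 - t) = (m + 1) ^ (m + 1 - (t + 1)) * (m + 1) := by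
      rw [← pow_succ]; congr 1; omega
    rw [h3, Nat.add_sub_cancel, ← mul_assoc]
    gcongr
  have h2 : (n : ℝ) ^ n / n.factorial ≤ Real.exp n :=
    Real.pow_div_factorial_le_exp (n : ℝ) hn.le n
  have hf : (0 : ℝ) < n.factorial := by exact_mod_cast n.factorial_pos
  rw [div_le_iff₀ hf] at h2
  have h3 : (n : ℝ) ^ n ≤ Real.exp n * (n ^ (n - t) * (n - 1).descFactorial t) := by
    refine h2.trans ?_
    gcongr
    exact_mod_cast h1
  have h4 := Real.log_le_log (by positivity) h3
  rw [Real.log_mul (by positivity) (by positivity), Real.log_mul (by positivity) (by positivity),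
    Real.log_pow, Real.log_pow, Real.log_exp, Nat.cast_sub ht.le] at h4
  linarith

/-- In the first `β M / 8` blocks the fraction of roots not yet processed is close to `1`. -/
theorem log_block_ge {β : ℝ} (hβ : 0 < β) (hβ1 : β ≤ 1) {M : ℕ} (k : Fin M)
    (hk : (k : ℝ) ≤ β * M / 8) : -(β / 2) ≤ Real.log ((((M : ℝ) - k) / M) ^ 2) := by
  have hM : (0 : ℝ) < M := by exact_mod_cast k.pos
  have h1 : 1 - β / 8 ≤ ((M : ℝ) - k) / M := by
    rw [le_div_iff₀ hM]; linarith
  have h2 : 0 < 1 - β / 8 := by linarith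
  have h3 := Real.one_sub_inv_le_log_of_pos h2
  have h4 : (1 - β / 8)⁻¹ ≤ 1 + β / 4 := by
    rw [inv_le_iff_one_le_mul₀ h2]; nlinarith
  have h5 := Real.log_le_log h2 h1
  rw [Real.log_pow]
  push_cast
  linarith

end Estimates

/-! ### Typical subgraphs of super-regular graphs -/

section Conclusion

variable {V : Fin 3 → Type*} [∀ i, Fintype (V i)]

theorem triangleCount_le_sq (G : SimpleGraph (Σ i, V i)) {n : ℕ} (hV : ∀ i, Fintype.card (V i) = n)
    {i : Fin 3} (x : V i) (j k : Fin 3) : (triangleCount G x j k : ℝ) ≤ n ^ 2 := by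
  classical
  have h : triangleCount G x j k ≤ n * n := by
    refine (Finset.card_filter_le _ _).trans_eq ?_
    rw [Finset.card_univ, Fintype.card_prod, hV, hV]
  rw [sq]
  exact_mod_cast h

theorem IsTypical.triangleCount_le_const {Γ G : SimpleGraph (Σ i, V i)} {n : ℕ}
    (hV : ∀ i, Fintype.card (V i) = n) {p θ c : ℝ} (hp : 0 ≤ p) (hθ1 : θ ≤ 1)
    (h : IsTypical Γ G p (26 * θ * (p ^ 3 * n ^ 2)) c) (i j k : Fin 3) (hij : i ≠ j) (hik : i ≠ k)
    (hjk : j ≠ k) (x : V i) : (triangleCount G x j k : ℝ) ≤ 27 * (p ^ 3 * n ^ 2) := by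
  have h1 := h.triangleCount_le i j k hij hik hjk x
  have h2 := mul_le_mul_of_nonneg_left (triangleCount_le_sq Γ hV x j k) (pow_nonneg hp 3)
  have h3 : θ * (p ^ 3 * (n : ℝ) ^ 2) ≤ 1 * (p ^ 3 * n ^ 2) := by gcongr
  linarith

/-- In a typical subgraph of a super-regular graph, the relative excess of the triangle counts over
the benchmark is small on average. -/
theorem IsTypical.exists_relative_excess {Γ G : SimpleGraph (Σ i, V i)} {n : ℕ}
    (hV : ∀ i, Fintype.card (V i) = n) {p θ c d : ℝ} (hp : 0 ≤ p) (hθ : 0 < θ)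
    (hθ1 : θ ≤ 1) (hd : 0 < d) (hd1 : d ≤ 1) (hΓ : IsSuperRegularTripartite Γ θ d)
    (h : IsTypical Γ G p (26 * θ * (p ^ 3 * n ^ 2)) c) (ℓ : Fin 3) :
    ∃ e : V ℓ → ℝ, (∀ a, 0 ≤ e a) ∧ ∑ a, e a ≤ 88 * θ / d ^ 3 * n ∧
      ∀ a, (triangleCount G a (ℓ + 1) (ℓ + 2) : ℝ) ≤ (1 + e a) * ((p * d) ^ 3 * n ^ 2) := by
  classical
  obtain ⟨e1, e2, e3⟩ := fin_three_ne ℓ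
  have hd3 : 0 < d ^ 3 := by positivity
  have hq : 0 ≤ p ^ 3 * (n : ℝ) ^ 2 := by positivity
  obtain ⟨X, hX, hXtri⟩ := exists_card_triangles_le (Γ := Γ) (n := n)
    (hΓ.2 ℓ (ℓ + 1) e1.symm).1 (hΓ.2 ℓ (ℓ + 2) e2.symm).1 (hΓ.2 (ℓ + 1) (ℓ + 2) e3.symm).1
    (by rw [card_partSet, hV]) (by rw [card_partSet, hV]) (by rw [card_partSet, hV])
    hθ hθ1 hd.le hd1
  refine ⟨fun a => 34 * θ / d ^ 3 + if (⟨ℓ, a⟩ : Σ i, V i) ∈ X then 27 / d ^ 3 else 0,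
    fun a => ?_, ?_, fun a => ?_⟩
  · dsimp only
    split_ifs <;> positivity
  · rw [Finset.sum_add_distrib, ← Finset.sum_filter]
    simp only [Finset.sum_const, nsmul_eq_mul, Finset.card_univ, hV]
    have h1 : ((Finset.univ.filter fun a : V ℓ => (⟨ℓ, a⟩ : Σ i, V i) ∈ X).card : ℝ) ≤
        2 * θ * n := by
      refine le_trans ?_ hX
      have : (Finset.univ.filter fun a : V ℓ => (⟨ℓ, a⟩ : Σ i, V i) ∈ X).card ≤ X.card :=
        Finset.card_le_card_of_injOn (fun a => ⟨ℓ, a⟩) (fun a ha => by simpa using ha)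
          (fun a _ b _ hab => by simpa using hab)
      exact_mod_cast this
    have h2 := mul_le_mul_of_nonneg_right h1 (by positivity : 0 ≤ 27 / d ^ 3)
    refine (add_le_add_right h2 _).trans_eq ?_
    field_simp
    ring
  · have hscale : ∀ q : ℝ, (1 + q / d ^ 3) * ((p * d) ^ 3 * (n : ℝ) ^ 2) =
        (d ^ 3 + q) * (p ^ 3 * n ^ 2) := by
      intro q; field_simp
    by_cases ha : (⟨ℓ, a⟩ : Σ i, V i) ∈ X
    · have h1 := h.triangleCount_le_const hV hp hθ1 ℓ (ℓ + 1) (ℓ + 2) e1.symm e2.symm e3.symm a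
      simp only [if_pos ha]
      rw [← add_div, hscale]
      refine h1.trans ?_
      gcongr
      linarith
    · have h1 := h.triangleCount_le ℓ (ℓ + 1) (ℓ + 2) e1.symm e2.symm e3.symm a
      have h2 := hXtri ⟨ℓ, a⟩ (mem_partSet.2 rfl) ha
      rw [card_filter_partSet_product] at h2
      have h3 : (triangleCount Γ a (ℓ + 1) (ℓ + 2) : ℝ) ≤ (d ^ 3 + 8 * θ) * n ^ 2 := by
        rw [triangleCount]
        exact h2
      have h4 := mul_le_mul_of_nonneg_left h3 (pow_nonneg hp 3)
      simp only [if_neg ha, add_zero]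
      rw [hscale]
      linarith

/-- The numerical comparison behind `IsTypical.ncard_le`: `Q` is the logarithm of the number of
embeddings, `F` that of a falling factorial, `a` and `b` are the logarithms of `p d` and `n`, and
`x` is the number of bad vertices. -/
theorem bad_le_of_log_bounds {n t M E β θ d T a b F G Q x : ℝ} (hn : 0 < n) (ht0 : 0 ≤ t)
    (htn : t ≤ n) (ht1 : (1 - θ) * n ≤ t) (hβ : 0 < β) (hβ1 : β ≤ 1) (hθ : 0 < θ) (hd : 0 < d)
    (hd1 : d ≤ 1) (hMr : 1 ≤ M) (hT0 : 0 < T) (hθM : 20000 * M ^ 2 * θ ≤ β ^ 3 * d ^ 3)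
    (hMsum : G ≤ -2 + β ^ 3 / 200) (hE1 : β * M / 8 ≤ E) (hdesc : t * b - n ≤ F)
    (hlower : n * Real.log (1 - θ) + 3 * t * a + 3 * F ≤ Q)
    (hupper : Q ≤ F + t * (3 * a + 2 * b + G) + 88 * θ / d ^ 3 * n +
      M ^ 2 * (3 * t * (3 * (θ ^ 2 * (T / d ^ 3))) + 2 * (n - t) * (27 * (T / d ^ 3))) / T -
      β / 2 * (E / M) * (x - (n - t))) : x ≤ β * n := by
  have hd3 : 0 < d ^ 3 := by positivity
  have hd31 : d ^ 3 ≤ 1 := pow_le_one₀ hd.le hd1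
  have hβ2 : β ^ 2 ≤ 1 := pow_le_one₀ hβ.le hβ1
  have hβ3 : 0 < β ^ 3 := by positivity
  have hβ31 : β ^ 3 ≤ β := by nlinarith
  -- each error term below is at most `β³ n / 200`, the gain in `f5` is at least `β³ n / 32`
  have g1 : M ^ 2 * (θ / d ^ 3) ≤ β ^ 3 / 20000 := by
    rw [← mul_div_assoc, div_le_div_iff₀ hd3 (by norm_num)]
    linarith
  have hθd : θ ≤ θ / d ^ 3 := by
    rw [le_div_iff₀ hd3]; nlinarith
  have g2 : θ / d ^ 3 ≤ β ^ 3 / 20000 := by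
    refine le_trans ?_ g1
    exact le_mul_of_one_le_left (by positivity) (by nlinarith)
  have hθβ : θ ≤ β / 20000 := by linarith
  have hθ1 : θ ≤ 1 := by linarith
  have hθ1' : 0 < 1 - θ := by linarith
  have hnt : n - t ≤ θ * n := by linarith
  have hθ2 : θ ≤ β ^ 3 / 20000 := hθd.trans g2
  have f1 : -(2 * θ) ≤ Real.log (1 - θ) := by
    have h1 := Real.one_sub_inv_le_log_of_pos hθ1'
    have h2 : (1 - θ)⁻¹ ≤ 1 + 2 * θ := by
      rw [inv_le_iff_one_le_mul₀ hθ1']; nlinarith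
    linarith
  have f2 : M ^ 2 * (3 * t * (3 * (θ ^ 2 * (T / d ^ 3))) +
      2 * (n - t) * (27 * (T / d ^ 3))) / T ≤ 63 * β ^ 3 / 20000 * n := by
    have h1 : M ^ 2 * (3 * t * (3 * (θ ^ 2 * (T / d ^ 3))) +
        2 * (n - t) * (27 * (T / d ^ 3))) / T =
        M ^ 2 / d ^ 3 * (9 * (t * θ ^ 2) + 54 * (n - t)) := by
      field_simp
      ring
    have h2 : t * θ ^ 2 ≤ θ * n := by
      have : θ ^ 2 ≤ θ := by nlinarith
      calc t * θ ^ 2 ≤ n * θ := by gcongr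
        _ = _ := mul_comm _ _
    rw [h1]
    calc M ^ 2 / d ^ 3 * (9 * (t * θ ^ 2) + 54 * (n - t))
        ≤ M ^ 2 / d ^ 3 * (63 * (θ * n)) := by
          gcongr
          linarith
      _ = 63 * n * (M ^ 2 * (θ / d ^ 3)) := by ring
      _ ≤ 63 * n * (β ^ 3 / 20000) := by gcongr
      _ = _ := by ring
  have f3 : 88 * θ / d ^ 3 * n ≤ 88 * β ^ 3 / 20000 * n := by
    have : 88 * θ / d ^ 3 ≤ 88 * β ^ 3 / 20000 := by
      rw [mul_div_assoc, mul_div_assoc]; gcongr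
    gcongr
  have f4 : t * G ≤
      (-2 + β ^ 3 / 200 + 2 * θ) * n := by
    have h1 : t * G ≤
        t * (-2 + β ^ 3 / 200) := by gcongr
    have h2 : t * (2 - β ^ 3 / 200) ≥ ((1 - θ) * n) * (2 - β ^ 3 / 200) :=
      mul_le_mul_of_nonneg_right ht1 (by linarith)
    have h3 : 0 ≤ θ * n * (β ^ 3 / 200) := by positivity
    linarith
  by_contra! hlt
  have f5 : β ^ 3 / 32 * n ≤ β / 2 * (E / M) * (x - (n - t)) := by
    have h1 : β / 8 ≤ E / M := by
      rw [le_div_iff₀ (by linarith)]; linarith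
    have h2 : β / 2 * n ≤ x - (n - t) := by
      have h3 : θ * n ≤ β / 2 * n := mul_le_mul_of_nonneg_right (by linarith) hn.le
      linarith
    have h3 : 0 ≤ E / M := (by positivity : 0 ≤ β / 8).trans h1
    calc β ^ 3 / 32 * n = β / 2 * (β / 8) * (β / 2 * n) := by ring
      _ ≤ β / 2 * (E / M) * (x - (n - t)) := by gcongr
  have f6 := mul_le_mul_of_nonneg_left f1 hn.le
  have f7 := mul_le_mul_of_nonneg_right hθ2 hn.le
  have f8 : 0 < β ^ 3 * n := by positivity
  linarith

/-- In a typical subgraph, few vertices have small conditional entropy, provided that there are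
almost as many embeddings as expected. -/
theorem IsTypical.ncard_le {Γ G : SimpleGraph (Σ i, V i)} {n M t k : ℕ}
    (hV : ∀ i, Fintype.card (V i) = n) {p θ d β : ℝ} (hp : 0 < p) (hβ : 0 < β) (hβ1 : β ≤ 1)
    (hθ : 0 < θ) (hd : 0 < d) (hd1 : d ≤ 1) (hM : 0 < M)
    (hMsum : (∑ k : Fin M, Real.log ((((M : ℝ) - k) / M) ^ 2)) / M ≤ -2 + β ^ 3 / 200)
    (hθM : 20000 * (M : ℝ) ^ 2 * θ ≤ β ^ 3 * d ^ 3)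
    (hΓ : IsSuperRegularTripartite Γ θ d)
    (h : IsTypical Γ G p (26 * θ * (p ^ 3 * n ^ 2)) (3 * (θ ^ 2 * (p ^ 3 * n ^ 2))))
    (ht1 : (1 - θ) * (n : ℝ) ≤ t) (ht : t < n) {ℓ : Fin 3} (us : VertexTuple V k) (u : V ℓ)
    (hΨ : (embeddingsAvoiding G t us u).Nonempty)
    (hcard : (1 - θ) ^ n * (p * d) ^ (3 * t) * ((n - 1).descFactorial t : ℝ) ^ 3 ≤
      (embeddingsAvoiding G t us u).card) :
    ({v : V ℓ | ¬ HasCondEntropyAtLeast (embeddingsAvoiding G t us u) hΨ v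
      (benchmarkEntropy n p d - β)}.ncard : ℝ) ≤ β * n := by
  have hn : (0 : ℝ) < n := by exact_mod_cast (Nat.zero_le t).trans_lt ht
  have hMr : (1 : ℝ) ≤ M := by exact_mod_cast hM
  have hd3 : 0 < d ^ 3 := by positivity
  have hθ1' : θ < 1 := by
    have h1 : β ^ 3 * d ^ 3 ≤ 1 * 1 :=
      mul_le_mul (pow_le_one₀ hβ.le hβ1) (pow_le_one₀ hd.le hd1) hd3.le zero_le_one
    nlinarith
  have hθ1 : θ ≤ 1 := hθ1'.le
  have hη : 0 < 1 - θ := by linarith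
  set T : ℝ := (p * d) ^ 3 * n ^ 2 with hT
  have hT0 : 0 < T := by positivity
  have hTp : p ^ 3 * (n : ℝ) ^ 2 = T / d ^ 3 := by rw [hT]; field_simp
  obtain ⟨e, he0, hesum, hetri⟩ := h.exists_relative_excess hV hp.le hθ hθ1 hd hd1 hΓ ℓ
  -- the number of early blocks
  let E := ⌊β * M / 8⌋₊ + 1
  have hE1 : β * M / 8 ≤ E := by
    have := Nat.lt_floor_add_one (β * M / 8)
    push_cast [E]
    exact this.le
  have hEM : E ≤ M := by
    have : ⌊β * (M : ℝ) / 8⌋₊ < M := by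
      rw [Nat.floor_lt (by positivity)]
      nlinarith
    exact this
  have hE : ∀ k : Fin M, (k : ℕ) < E → -(β / 2) ≤ Real.log ((((M : ℝ) - k) / M) ^ 2) := by
    intro k hk
    refine log_block_ge hβ hβ1 k ?_
    exact (Nat.le_floor_iff (by positivity)).1 (Nat.lt_succ_iff.1 hk)
  have hupper := log_card_embeddingsAvoiding_le hV ht us u hΨ hT0 hβ.le he0 hM hEM hesum hetri
    (fun i j k hij hik hjk x => h.triangleCount_le_const hV hp.le hθ1 i j k hij hik hjk x)
    h.codegree_le hE
  have hdF : (0 : ℝ) < ((n - 1).descFactorial t : ℝ) := by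
    exact_mod_cast Nat.descFactorial_pos.2 (by omega)
  have hlower := Real.log_le_log (by positivity) hcard
  rw [Real.log_mul (by positivity) (by positivity), Real.log_mul (by positivity) (by positivity),
    Real.log_pow, Real.log_pow, Real.log_pow] at hlower
  have hlogT : Real.log T = 3 * Real.log (p * d) + 2 * Real.log n := by
    rw [hT, Real.log_mul (by positivity) (by positivity), Real.log_pow, Real.log_pow]
    norm_num
  rw [hlogT, hTp] at hupper
  push_cast at hlower
  exact bad_le_of_log_bounds hn (Nat.cast_nonneg t) (by exact_mod_cast ht.le) ht1 hβ hβ1 hθ hd hd1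
    hMr hT0 hθM hMsum hE1 (log_descFactorial_pred_ge ht) hlower
    (by rw [← hlogT] at hupper ⊢; exact hupper)

end Conclusion

/-- The hypothesis on `p` makes the order `p³ n²` of the triangle counts, and the order `p n` of the
degrees, a large multiple of `log n`. -/
theorem mul_log_le_of_le_edge_probability {n : ℕ} (hn : 1 ≤ Real.log n)
    (hlog : Real.log n ^ 2 ≤ n) {p C : ℝ} (hC : 1 ≤ C)
    (hp : C * Real.log n ^ (1 / 3 : ℝ) * (n : ℝ) ^ (-(2 / 3) : ℝ) ≤ p) :
    C * Real.log n ≤ p ^ 3 * n ^ 2 ∧ C * Real.log n ≤ p * n := by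
  have hl0 : 0 < Real.log n := by linarith
  have hn0 : (0 : ℝ) < n := by nlinarith
  have hq : 0 ≤ C * Real.log n ^ (1 / 3 : ℝ) * (n : ℝ) ^ (-(2 / 3) : ℝ) := by positivity
  have hp0 : 0 ≤ p := hq.trans hp
  have h1 : (C * Real.log n ^ (1 / 3 : ℝ) * (n : ℝ) ^ (-(2 / 3) : ℝ)) ^ 3 =
      C ^ 3 * Real.log n / n ^ 2 := by
    have e1 : (Real.log n ^ (1 / 3 : ℝ)) ^ 3 = Real.log n := by
      rw [← Real.rpow_natCast, ← Real.rpow_mul hl0.le]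
      norm_num
    have e2 : ((n : ℝ) ^ (-(2 / 3) : ℝ)) ^ 3 = ((n : ℝ) ^ 2)⁻¹ := by
      rw [← Real.rpow_natCast, ← Real.rpow_mul hn0.le,
        show -(2 / 3 : ℝ) * ((3 : ℕ) : ℝ) = -((2 : ℕ) : ℝ) by norm_num, Real.rpow_neg hn0.le,
        Real.rpow_natCast]
    rw [mul_pow, mul_pow, e1, e2, div_eq_mul_inv]
  have h2 := pow_le_pow_left₀ hq hp 3
  rw [h1, div_le_iff₀ (by positivity)] at h2
  have hC2 : 1 ≤ C ^ 2 := one_le_pow₀ hC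
  refine ⟨le_trans ?_ h2, ?_⟩
  · have : C ≤ C ^ 3 := le_self_pow₀ hC (by norm_num)
    gcongr
  · refine le_of_pow_le_pow_left₀ three_ne_zero (by positivity) ?_
    calc (C * Real.log n) ^ 3 = C ^ 3 * Real.log n * Real.log n ^ 2 := by ring
      _ ≤ C ^ 3 * Real.log n * n := by gcongr
      _ ≤ p ^ 3 * n ^ 2 * n := by gcongr
      _ = (p * n) ^ 3 := by ring

end

/-- Here the classes are indexed by `0, 1, 2`; in terms of indices `1, 2, 3`, the class of `u` has
index `ℓ + 1`, and `us` has one vertex in each of the `ℓ` earlier classes. -/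
theorem lemma6p2 (β d L : ℝ) (hβ : 0 < β) (hβ1 : β ≤ 1) (hd : 0 < d) (hd1 : d ≤ 1)
    (hL : 0 < L) :
    ∃ η ε C : ℝ, 0 < η ∧ η < 1 ∧ 0 < ε ∧ 0 < C ∧ ∃ n₀ : ℕ, ∀ n : ℕ, n₀ ≤ n →
      ∀ p : unitInterval,
        C * Real.log n ^ (1 / 3 : ℝ) * (n : ℝ) ^ (-(2 / 3) : ℝ) ≤ (p : ℝ) →
      ∀ (V : Fin 3 → Type*) [∀ i, Fintype (V i)], (∀ i, Fintype.card (V i) = n) →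
      ∀ Γ : SimpleGraph (Σ i, V i), IsSuperRegularTripartite Γ ε d →
      ∀ t : ℕ, (1 - η) * (n : ℝ) ≤ (t : ℝ) → t < n →
      ∀ (ℓ : Fin 3) (us : VertexTuple V ℓ) (u : V ℓ),
        1 - (n : ℝ) ^ (-L) ≤ (sparsification Γ p).real
          {G | (1 - η) ^ n * ((p : ℝ) * d) ^ (3 * t) *
                  ((n - 1).descFactorial t : ℝ) ^ ((ℓ : ℕ) + 1) *
                  (n.descFactorial t : ℝ) ^ (2 - (ℓ : ℕ))
                ≤ ((embeddingsAvoiding G t us u).card : ℝ) →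
              ∃ hΨ : (embeddingsAvoiding G t us u).Nonempty,
                ({v : V ℓ | ¬ HasCondEntropyAtLeast (embeddingsAvoiding G t us u) hΨ v
                    (benchmarkEntropy n p d - β)}.ncard : ℝ) ≤ β * n} := by

  obtain ⟨M, hM, hMsum⟩ := exists_sum_log_block_le (γ := β ^ 3 / 200) (by positivity)
  have hMr : (1 : ℝ) ≤ M := by exact_mod_cast hM
  -- one small parameter serves as `η`, as `ε`, and as the deviation in the tail bounds
  obtain ⟨θ, hθdef⟩ : ∃ θ : ℝ, θ = β ^ 3 * d ^ 3 / (20000 * (M : ℝ) ^ 2) := ⟨_, rfl⟩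
  have hθ : 0 < θ := by rw [hθdef]; positivity
  have hθM : 20000 * (M : ℝ) ^ 2 * θ ≤ β ^ 3 * d ^ 3 := by
    rw [hθdef, mul_div_cancel₀ _ (by positivity)]
  have hθ1 : θ < 1 := by
    have h1 : β ^ 3 * d ^ 3 ≤ 1 * 1 :=
      mul_le_mul (pow_le_one₀ hβ.le hβ1) (pow_le_one₀ hd.le hd1) (by positivity) zero_le_one
    nlinarith
  have hθ2 : θ ^ 2 ≤ 1 := pow_le_one₀ hθ.le hθ1.le
  have hC : 1 ≤ (L + 3) / θ ^ 2 := by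
    rw [le_div_iff₀ (by positivity)]; linarith
  have hev : ∀ᶠ n : ℕ in Filter.atTop, Real.log n ^ 2 ≤ n := by
    have h := (isLittleO_log_rpow_atTop (by norm_num : (0 : ℝ) < 1 / 2)).bound one_pos
    filter_upwards [tendsto_natCast_atTop_atTop.eventually h] with n hn
    rw [one_mul, Real.norm_eq_abs, Real.norm_eq_abs, ← sq_le_sq, ← Real.sqrt_eq_rpow,
      Real.sq_sqrt (Nat.cast_nonneg n)] at hn
    exact hn
  obtain ⟨N, hN⟩ := Filter.eventually_atTop.1 hev
  refine ⟨θ, θ, (L + 3) / θ ^ 2, hθ, hθ1, hθ, by linarith, max N 162, ?_⟩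
  intro n hn p hp V _ hV Γ hΓ t ht1 ht ℓ us u
  have hn162 : (162 : ℝ) ≤ n := by exact_mod_cast (le_max_right N 162).trans hn
  have hlog1 : 1 ≤ Real.log n := by
    rw [Real.le_log_iff_exp_le (by linarith)]
    linarith [Real.exp_one_lt_d9]
  obtain ⟨hp3, hpn⟩ := mul_log_le_of_le_edge_probability hlog1 (hN n ((le_max_left N 162).trans hn))
    hC hp
  have hn0 : (0 : ℝ) < n := by linarith
  have hp0 : 0 < (p : ℝ) := by
    have : 0 < (p : ℝ) * n := lt_of_lt_of_le (by positivity) hpn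
    exact pos_of_mul_pos_left this hn0.le
  have hscale : ∀ q : ℝ, (L + 3) / θ ^ 2 * Real.log n ≤ q → (L + 3) * Real.log n ≤ θ ^ 2 * q := by
    intro q hq
    have := mul_le_mul_of_nonneg_left hq (sq_nonneg θ)
    rwa [← mul_assoc, mul_div_cancel₀ _ (by positivity)] at this
  have hk1 := hscale _ hpn
  have hk2 := hscale _ hp3
  have hpn0 : 0 ≤ (p : ℝ) * n := by positivity
  have htyp := one_sub_le_sparsification_isTypical hV (by exact_mod_cast hn0) Γ p hp0
    (k := (L + 3) * Real.log n) (m := θ ^ 2 * ((p : ℝ) ^ 3 * n ^ 2)) hθ hθ1.le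
    (hk1.trans (mul_le_of_le_one_left hpn0 hθ2)) hk1 hk2 hk2 (by
      have h1 : 3 ≤ θ ^ 2 * ((p : ℝ) * n) := by nlinarith
      calc 3 * (p : ℝ) ^ 2 * n ≤ θ ^ 2 * ((p : ℝ) * n) * (p : ℝ) ^ 2 * n := by gcongr
        _ = _ := by ring)
  have hprob : 162 * (n : ℝ) ^ 2 * Real.exp (-((L + 3) * Real.log n)) ≤ (n : ℝ) ^ (-L) := by
    have h1 : Real.exp (-((L + 3) * Real.log n)) = (n : ℝ) ^ (-L) / (n : ℝ) ^ 3 := by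
      rw [← Real.rpow_natCast, ← Real.rpow_sub hn0, Real.rpow_def_of_pos hn0]
      congr 1
      push_cast
      ring
    have h2 : 0 ≤ (n : ℝ) ^ (-L) := by positivity
    rw [h1, mul_div_assoc', div_le_iff₀ (by positivity)]
    calc 162 * (n : ℝ) ^ 2 * (n : ℝ) ^ (-L) ≤ n * (n : ℝ) ^ 2 * (n : ℝ) ^ (-L) := by gcongr
      _ = _ := by ring
  have hfin : IsFiniteMeasure (sparsification Γ p) := by
    classical
    unfold sparsification
    infer_instance
  refine le_trans (by linarith) (htyp.trans (measureReal_mono ?_))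
  intro G hG hcard
  have hdF : (0 : ℝ) < ((n - 1).descFactorial t : ℝ) := by
    exact_mod_cast Nat.descFactorial_pos.2 (by omega)
  have hη : 0 < 1 - θ := by linarith
  have hcard' : (1 - θ) ^ n * ((p : ℝ) * d) ^ (3 * t) * ((n - 1).descFactorial t : ℝ) ^ 3 ≤
      (embeddingsAvoiding G t us u).card := by
    refine le_trans ?_ hcard
    have h1 : ((n - 1).descFactorial t : ℝ) ≤ (n.descFactorial t : ℝ) := by
      exact_mod_cast Nat.descFactorial_le t (Nat.sub_le n 1)
    have h2 : ((n - 1).descFactorial t : ℝ) ^ 3 = ((n - 1).descFactorial t : ℝ) ^ ((ℓ : ℕ) + 1) *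
        ((n - 1).descFactorial t : ℝ) ^ (2 - (ℓ : ℕ)) := by
      rw [← pow_add]
      congr 1
      omega
    rw [h2, ← mul_assoc]
    gcongr
  have hΨ : (embeddingsAvoiding G t us u).Nonempty := by
    rw [← Finset.card_pos]
    have : (0 : ℝ) < (embeddingsAvoiding G t us u).card := lt_of_lt_of_le (by positivity) hcard'
    exact_mod_cast this
  exact ⟨hΨ, IsTypical.ncard_le hV hp0 hβ hβ1 hθ hd hd1 hM hMsum hθM hΓ hG ht1 ht us u hΨ hcard'⟩
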